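/- Let $A$ be a non-empty linearly ordered set (the alphabet), let $\sim$ be the least congruence on $A^*$ containing $(w,w^2)$ for all $w\in A^*$, and let $\mathrm{FB}^1(A)=A^*/{\sim}$ be the free band with identity adjoined. For $x\in \mathrm{FB}^1(A)$ let $\min(x)$ be the short-lex least word representing $x$. Write $\bot$ for "undefined". **Transducers.** For $w\in A^+$ with set of letters $\mathrm{cont}(w)$ let $w\circ 0$ (resp. $w\circ 1$) be the longest prefix (resp. suffix) of $w$ with $|\mathrm{cont}(w)|-1$ distinct letters, let $w*0$ be the letter of $w$ following the prefix $w\circ 0$, and $w*1$ the letter of $w$ preceding the suffix $w\circ 1$. Define partial functions $f_w:\{0,1\}^*\to A^*$ by $f_\varepsilon(\varepsilon)=\varepsilon$, $f_\varepsilon(\alpha)=\bot$ for $\alpha\ne\varepsilon$, and, for $w\neq\varepsilon$, $f_w(\varepsilon)=\bot$ and $f_w(\beta\gamma)=(w*\beta)\,f_{w\circ\beta}(\gamma)$ for $\beta\in\{0,1\}$, $\gamma\in\{0,1\}^*$. A transducer is $(Q,\{0,1\},A,q_0,T,\spadesuit,\clubsuit)$ with $q_0\in Q$, $\varnothing\ne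 T\subseteq Q$ and partial functions $\spadesuit:Q\times\{0,1\}\to Q$ (next state) and $\clubsuit:Q\times\{0,1\}\to A$ (output letter) with the same domain, both extended to input words letter by letter. It realizes the partial function that maps $\alpha$ to the output word $q_0\clubsuit\alpha$ if $q_0\spadesuit\alpha\in T$, and is undefined at all other $\alpha$. The minimal transducer $\mathcal T_x$ representing $x=w/{\sim}$ is the transducer with the least number of states realizing $f_w$ (unique up to isomorphism). **Algorithm.** Indices in words start at $1$; $w_{(i,j)}$ is the subword of $w$ from index $i$ to index $j$, and is $\varepsilon$ unless $0<i\le j$. For $q\in Q$ let $c(q)$ be the least $n$ with $q\spadesuit 0^n\in T$. $\mathrm{ClassifyCase}(\mathcal T,q)$: compute $c(q)$ by following transitions on $0$. If $q\clubsuit0=q\clubsuit1$, return (case (i), $c(q)$). Otherwise set $u\gets q\spadesuit0$, $v\gets q\spadesuit1$, and for $k=1,\dots,c(q)$: if $u\clubsuit1=q\clubsuit1$, $v\clubsuit0=q\clubsuit0$ and $u\spadesuit1=v\spadesuit0$, return (case (ii), $k$); set $u\gets u\spadesuit1$, $v\gets v\spadesuit0$; if $u$ or $v$ is terminal, return (case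 (iii), $c(q)$). $\mathrm{MinWord}(\mathcal T,q,w,l,B)$, for $q\in Q$, $w\in A^*$, $l\in\mathbb N_0$ and a partial function $B:Q\to\mathbb N_0\times\mathbb N_0$: set $s\gets|w|-l+1$. If $B(q)=(i,j)$ is defined, return $(w\,w_{(i+l,j)},B)$. Otherwise do the following in order: $(w,B)\gets\mathrm{MinWord}(\mathcal T,q\spadesuit0,w,l,B)$; determine the case and $k$ by $\mathrm{ClassifyCase}(\mathcal T,q)$; in case (i) set $w\gets w(q\clubsuit0)$ and $l'\gets0$, in case (ii) set $l'\gets|w_{B(q\spadesuit01^k)}|$, in case (iii) set $w\gets w(q\clubsuit0)(q\clubsuit1)$ and $l'\gets0$; $(w,B)\gets\mathrm{MinWord}(\mathcal T,q\spadesuit1,w,l',B)$; $B(q)\gets(s,|w|)$; return $(w,B)$. **Cost model.** In the RAM model, each of the following takes one unit of time: reading $q\spadesuit\alpha$, $q\clubsuit\alpha$ or $B(q)$, testing whether $q\in T$, defining a value $B(q)$, reading the length or a letter of $w$, appending a letter to $w$, an arithmetic operation or comparison, starting or ending a call. The word $w$ and the map $B$ are modified in place. The space used is the largest number of memory cells ever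 occupied by $\mathcal T_x$, $B$, $w$ and the recursion stack, with boundedly many cells per state, per letter of $w$ and per active call. **Theorem.** Let $x\in\mathrm{FB}^1(A)$, let $\mathcal T_x=(Q,\{0,1\},A,q_0,T,\spadesuit,\clubsuit)$ be the minimal transducer representing $x$, and let $B(q)=(0,0)$ for $q\in T$ and $B(q)=\bot$ for $q\in Q\setminus T$. Then $Q$ is finite, $\mathrm{MinWord}(\mathcal T_x,q_0,\varepsilon,0,B)$ halts, and the first component of its value is $\min(x)$. If moreover $A$ is finite, it runs in time $\mathcal O(|A|\cdot|Q|+|\min(x)|)$ and space $\mathcal O(|Q|+|\min(x)|)$; and if also $x\neq\varepsilon$, then $|A|\cdot|Q|+|\min(x)|=\mathcal O(|A|^2\cdot|\min(x)|)$ and $|Q|+|\min(x)|=\mathcal O(|A|\cdot|\min(x)|)$, so that these are bounds for the time and the space, respectively. All implied constants are absolute. -/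

import Mathlib

namespace FreeBands

/-! ### Words, the free band with identity, short-lex least words -/

section Words

/-- The least congruence `∼` on the free monoid `A*` containing all pairs `(w, w²)`. -/
def bandCon (A : Type) : Con (FreeMonoid A) :=
  conGen fun u v => v = u * u

/-- The free band with identity adjoined, `FB¹(A) = A* / ∼`; its identity `1` is the class of
the empty word. -/
abbrev FreeBand (A : Type) : Type := (bandCon A).Quotient

/-- The element `w/∼` of `FB¹(A)` represented by the word `w`. -/
def FreeBand.ofWord {A : Type} (w : List A) : FreeBand A :=
  (bandCon A).mk' (FreeMonoid.ofList w)

/-- `w = min(x)`: the word `w` is the short-lex least word representing `x`. -/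
def IsMinWord {A : Type} [LinearOrder A] (x : FreeBand A) (w : List A) : Prop :=
  FreeBand.ofWord w = x ∧
    ∀ v : List A, FreeBand.ofWord v = x → v = w ∨ List.Shortlex (· < ·) w v

variable {A : Type} [DecidableEq A]

/-- `|cont(w)|`, the number of distinct letters of `w`. -/
def contCard (w : List A) : ℕ := w.toFinset.card

/-- `w ∘ 0` (resp. `w ∘ 1`): the longest prefix (resp. suffix) of `w` with exactly one distinct
letter fewer than `w`; undefined (`none`) for the empty word. The lists `w.inits.reverse` and
`w.tails` enumerate the prefixes and the suffixes from the longest to the shortest. -/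
def circ (w : List A) : Fin 2 → Option (List A)
  | 0 => w.inits.reverse.find? fun u => contCard u + 1 = contCard w
  | 1 => w.tails.find? fun u => contCard u + 1 = contCard w

/-- `w ∗ 0` is the letter of `w` right after the prefix `w ∘ 0`, and `w ∗ 1` is the letter of `w`
right before the suffix `w ∘ 1`; undefined for the empty word. -/
def star (w : List A) : Fin 2 → Option A
  | 0 => (circ w 0).bind fun u => w[u.length]?
  | 1 => (circ w 1).bind fun u => w[w.length - u.length - 1]?

/-- The partial function `f_w : {0,1}* → A*`: `f_ε(ε) = ε`, `f_ε(α) = ⊥` for `α ≠ ε`, and for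
nonempty `w`, `f_w(ε) = ⊥` and `f_w(βγ) = (w ∗ β) f_{w ∘ β}(γ)` for a letter `β`. (For `w = ε`
the last clause gives `⊥` because `ε ∗ β = ⊥`.) -/
def wordFun : List A → List (Fin 2) → Option (List A)
  | [], [] => some []
  | _ :: _, [] => none
  | w, β :: γ => do
      let a ← star w β
      let u ← circ w β
      let r ← wordFun u γ
      return a :: r

end Words

/-! ### Deterministic synchronous transducers -/

/-- A deterministic synchronous transducer with state set `Q`, input alphabet `S` and output
alphabet `G`. -/
structure Transducer (Q : Type) (S : Type) (G : Type) where
  /-- the initial state -/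
  init : Q
  /-- the set of terminal states -/
  terminal : Set Q
  terminal_nonempty : terminal.Nonempty
  /-- the state transition function `q ♠ a` -/
  next : Q → S → Option Q
  /-- the letter transition function `q ♣ a` -/
  out : Q → S → Option G
  next_isSome_iff : ∀ q a, (next q a).isSome ↔ (out q a).isSome

namespace Transducer

variable {Q : Type} {S G : Type}

/-- The extension of `♠` to input words. -/
def nextWord (T : Transducer Q S G) : Q → List S → Option Q
  | q, [] => some q
  | q, a :: α => (T.next q a).bind fun p => T.nextWord p α

/-- The extension of `♣` to input words: the output word along the run from `q`. -/
def outWord (T : Transducer Q S G) : Q → List S → Option (List G)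
  | _, [] => some []
  | q, a :: α => do
      let b ← T.out q a
      let p ← T.next q a
      let r ← T.outWord p α
      return b :: r

/-- The language accepted by `T`. -/
def language (T : Transducer Q S G) : Set (List S) :=
  {α | ∃ p ∈ T.terminal, T.nextWord T.init α = some p}

/-- `T` realizes the partial function `f`. -/
def Realizes (T : Transducer Q S G) (f : List S → Option (List G)) : Prop :=
  (∀ α ∈ T.language, f α = T.outWord T.init α) ∧ ∀ α ∉ T.language, f α = none

/-- `T` realizes `f` and has the least possible number of states. -/
def IsMinimalRealizing (T : Transducer Q S G) (f : List S → Option (List G)) : Prop :=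
  T.Realizes f ∧ ∀ (Q' : Type) (T' : Transducer Q' S G),
    T'.Realizes f → Cardinal.mk Q ≤ Cardinal.mk Q'

/-- `T` is the (unique up to isomorphism) minimal transducer representing `x ∈ FB¹(A)`, i.e. the
minimal transducer realizing `f_w`, where `w` is a word representing `x`. -/
def IsMinimalRepresenting {A : Type} [DecidableEq A] (T : Transducer Q (Fin 2) A)
    (x : FreeBand A) : Prop :=
  ∃ w : List A, FreeBand.ofWord w = x ∧ T.IsMinimalRealizing (wordFun w)

end Transducer

/-! ### The unit-cost random access machine

The memory holds the transducer (read only), the word `w` (a growing array) and the table of the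
partial function `B` (an array indexed by the states), both modified in place, and a stack of
activation records of recursive calls. A program can access the memory only through the elementary
operations below, each of which takes one unit of time, and it pays for arithmetic and comparisons
by `compute`. A program that aborts has the value `none`. Unbounded loops and recursions carry a
parameter `fuel` that bounds the number of nested calls in the evaluation; it is not a part of the
program, and `MinWordHaltsWith` below takes it to be sufficiently large. -/

/-- The memory, together with a clock and the largest number of cells occupied so far. -/
structure Mem (A : Type) (Q : Type) where
  /-- the word `w` -/
  word : List A
  /-- the partial function `B` -/
  table : Q → Option (ℕ × ℕ)
  /-- the number of activation records on the stack -/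
  frames : ℕ
  /-- the number of elementary operations performed so far -/
  time : ℕ
  /-- the largest number of memory cells in use at any moment so far -/
  peak : ℕ

/-- The number of memory cells in use: per state, five cells of the transducer (two transitions,
two output letters, the terminal flag) and three of the table (a flag and two integers); one cell
per letter of `w`; a fixed number of cells per activation record (parameters, local variables and
return address); and a fixed number of global registers. -/
noncomputable def cells {A : Type} (Q : Type) (w : List A) (frames : ℕ) : ℕ :=
  8 * Nat.card Q + w.length + 32 * frames + 8

/-- Programs with result in `α`. -/
abbrev RAM (A Q α : Type) : Type := StateT (Mem A Q) Option α

namespace RAM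

variable {A Q α : Type}

/-- One elementary operation: it may fail (`none`), otherwise it returns a value and updates the
word, the table and the number of activation records; it takes one unit of time. -/
noncomputable def elementary
    (f : Mem A Q → Option (α × List A × (Q → Option (ℕ × ℕ)) × ℕ)) : RAM A Q α := fun m =>
  match f m with
  | none => none
  | some (r, w, B, d) => some (r,
      { word := w, table := B, frames := d, time := m.time + 1,
        peak := max m.peak (cells Q w d) })

/-- Start a call: push an activation record. -/
noncomputable def pushFrame : RAM A Q Unit :=
  elementary fun m => some ((), m.word, m.table, m.frames + 1)

/-- End a call: pop an activation record. -/
noncomputable def popFrame : RAM A Q Unit :=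
  elementary fun m => some ((), m.word, m.table, m.frames - 1)

/-- Read the transition `q ♠ a`. -/
noncomputable def next (T : Transducer Q (Fin 2) A) (q : Q) (a : Fin 2) : RAM A Q Q :=
  elementary fun m => (T.next q a).map fun p => (p, m.word, m.table, m.frames)

/-- Read the output letter `q ♣ a`. -/
noncomputable def out (T : Transducer Q (Fin 2) A) (q : Q) (a : Fin 2) : RAM A Q A :=
  elementary fun m => (T.out q a).map fun b => (b, m.word, m.table, m.frames)

/-- Test whether `q` is terminal. -/
noncomputable def isTerminal (T : Transducer Q (Fin 2) A) [DecidablePred (· ∈ T.terminal)]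
    (q : Q) : RAM A Q Bool :=
  elementary fun m => some (decide (q ∈ T.terminal), m.word, m.table, m.frames)

/-- Retrieve the value of `B` at `q` (`none` if `q` is not in the domain of `B`). -/
noncomputable def lookup (q : Q) : RAM A Q (Option (ℕ × ℕ)) :=
  elementary fun m => some (m.table q, m.word, m.table, m.frames)

/-- Define the value of `B` at `q`. -/
noncomputable def assign [DecidableEq Q] (q : Q) (ij : ℕ × ℕ) : RAM A Q Unit :=
  elementary fun m => some ((), m.word, Function.update m.table q (some ij), m.frames)

/-- The length `|w|`. -/
noncomputable def wordLength : RAM A Q ℕ :=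
  elementary fun m => some (m.word.length, m.word, m.table, m.frames)

/-- Read the letter of `w` at index `i`, where indices start at `1`. -/
noncomputable def readLetter (i : ℕ) : RAM A Q A :=
  elementary fun m => if i = 0 then none else
    (m.word[i - 1]?).map fun a => (a, m.word, m.table, m.frames)

/-- Append a letter to `w`. -/
noncomputable def appendLetter (a : A) : RAM A Q Unit :=
  elementary fun m => some ((), m.word ++ [a], m.table, m.frames)

/-- One arithmetic operation, comparison or assignment between registers, with result `r`. -/
noncomputable def compute (r : α) : RAM A Q α :=
  elementary fun m => some (r, m.word, m.table, m.frames)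

/-! ### The algorithm -/

/-- Append `w_i w_{i+1} ⋯` (`n` letters) to `w`. -/
noncomputable def copyLetters : ℕ → ℕ → RAM A Q Unit
  | _, 0 => compute ()
  | i, n + 1 => do
      let _ ← compute ()
      let a ← readLetter i
      appendLetter a
      let i' ← compute (i + 1)
      copyLetters i' n

/-- The length of `w_{(i,j)}`, which is `j - i + 1` if `0 < i ≤ j`, and otherwise `0` because
then `w_{(i,j)} = ε`. -/
noncomputable def subwordLength (i j : ℕ) : RAM A Q ℕ := do
  let b ← compute (decide (0 < i))
  let c ← compute (decide (i ≤ j))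
  if b && c then
    let d ← compute (j - i)
    compute (d + 1)
  else
    compute 0

/-- Replace `w` by `w w_{(i,j)}`. -/
noncomputable def appendSubword (i j : ℕ) : RAM A Q Unit := do
  let n ← subwordLength i j
  copyLetters i n

/-- The state `q ♠ aᵏ`. -/
noncomputable def nextIterate (T : Transducer Q (Fin 2) A) (q : Q) (a : Fin 2) : ℕ → RAM A Q Q
  | 0 => compute q
  | k + 1 => do
      let _ ← compute ()
      let p ← next T q a
      nextIterate T p a k

/-- `n` plus the length of the path labelled `00⋯0` from `q` to the first terminal state on it.
For `n = 0` and a state `q` of a transducer representing an element of `FB¹(A)` this is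
`|cont(Ψ(q))|`, where `Ψ(q)` is the element represented by `q`. -/
noncomputable def contentSize (T : Transducer Q (Fin 2) A) [DecidablePred (· ∈ T.terminal)]
    (fuel : ℕ) (q : Q) (n : ℕ) : RAM A Q ℕ :=
  match fuel with
  | 0 => failure
  | fuel + 1 => do
      let t ← isTerminal T q
      if t then
        return n
      else
        let p ← next T q 0
        let n' ← compute (n + 1)
        contentSize T fuel p n'

/-- The three ways in which the prefix `min(y ∘ 0)(y ∗ 0)` and the suffix `(y ∗ 1)min(y ∘ 1)` of
`min(y)` can overlap: in one letter; in a longer word; not at all. -/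
inductive OverlapCase
  | i
  | ii
  | iii

/-- The loop of `classifyCase` over `k`, with `c = |cont(Ψ(q))|` and `r` remaining values of `k`. -/
noncomputable def classifyLoop [DecidableEq A] [DecidableEq Q] (T : Transducer Q (Fin 2) A)
    [DecidablePred (· ∈ T.terminal)] (q : Q) (c : ℕ) :
    (r k : ℕ) → (u v : Q) → RAM A Q (OverlapCase × ℕ)
  | 0, _, _, _ => failure
  | r + 1, k, u, v => do
      let _ ← compute ()
      let u1 ← out T u 1
      let q1 ← out T q 1
      let b1 ← compute (decide (u1 = q1))
      let v0 ← out T v 0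
      let q0 ← out T q 0
      let b0 ← compute (decide (v0 = q0))
      let u' ← next T u 1
      let v' ← next T v 0
      let b ← compute (decide (u' = v'))
      if b1 && b0 && b then
        return (OverlapCase.ii, k)
      else
        let tu ← isTerminal T u'
        let tv ← isTerminal T v'
        if tu || tv then
          return (OverlapCase.iii, c)
        else
          let k' ← compute (k + 1)
          classifyLoop T q c r k' u' v'

/-- The algorithm `ClassifyCase(T, q)`. -/
noncomputable def classifyCase [DecidableEq A] [DecidableEq Q] (T : Transducer Q (Fin 2) A)
    [DecidablePred (· ∈ T.terminal)] (fuel : ℕ) (q : Q) : RAM A Q (OverlapCase × ℕ) := do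
  let c ← contentSize T fuel q 0
  let q0 ← out T q 0
  let q1 ← out T q 1
  let b ← compute (decide (q0 = q1))
  if b then
    return (OverlapCase.i, c)
  else
    let u ← next T q 0
    let v ← next T q 1
    classifyLoop T q c c 1 u v

/-- The part of `MinWord` between the two recursive calls: depending on the overlap case, append
letters to `w`; the result is `l'`. -/
noncomputable def extendWord (T : Transducer Q (Fin 2) A) (q : Q) (k : ℕ) :
    OverlapCase → RAM A Q ℕ
  | OverlapCase.i => do
      let a ← out T q 0
      appendLetter a
      compute 0
  | OverlapCase.ii => do
      let p ← next T q 0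
      let r ← nextIterate T p 1 k
      let b ← lookup r
      match b with
      | some (i, j) => subwordLength i j
      | none => failure
  | OverlapCase.iii => do
      let a ← out T q 0
      appendLetter a
      let a' ← out T q 1
      appendLetter a'
      compute 0

/-- The recursive procedure `MinWord` with parameters `T`, `q`, `l`, acting in place on the
parameters `w` and `B`, which are held in memory. -/
noncomputable def minWord [DecidableEq A] [DecidableEq Q] (T : Transducer Q (Fin 2) A)
    [DecidablePred (· ∈ T.terminal)] (fuel : ℕ) (q : Q) (l : ℕ) : RAM A Q Unit :=
  match fuel with
  | 0 => failure
  | fuel + 1 => do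
      pushFrame
      let n ← wordLength
      let d ← compute (n - l)
      let s ← compute (d + 1)
      let b ← lookup q
      match b with
      | some (i, j) =>
          let i' ← compute (i + l)
          appendSubword i' j
          popFrame
      | none =>
          let p ← next T q 0
          minWord T fuel p l
          let (c, k) ← classifyCase T fuel q
          let l' ← extendWord T q k c
          let r ← next T q 1
          minWord T fuel r l'
          let n' ← wordLength
          assign q (s, n')
          popFrame

end RAM

/-- `MinWord(T, q, w, l, B)`, started with clock `0` and an empty stack, halts with memory `m`. The
first component of the value of `MinWord(T, q, w, l, B)` is then `m.word`, the second one is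
`m.table`; the running time is `m.time` and the space used is `m.peak`. -/
def MinWordHaltsWith {A Q : Type} [DecidableEq A] [DecidableEq Q]
    (T : Transducer Q (Fin 2) A) [DecidablePred (· ∈ T.terminal)] (q : Q) (w : List A) (l : ℕ)
    (B : Q → Option (ℕ × ℕ)) (m : Mem A Q) : Prop :=
  ∃ N : ℕ, ∀ fuel ≥ N, RAM.minWord T fuel q l
    { word := w, table := B, frames := 0, time := 0, peak := cells Q w 0 } = some ((), m)

/-- The partial function that is `(0, 0)` at the terminal states and undefined elsewhere. -/
def initialTable {A Q : Type} (T : Transducer Q (Fin 2) A) [DecidablePred (· ∈ T.terminal)] :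
    Q → Option (ℕ × ℕ) :=
  fun q => if q ∈ T.terminal then some (0, 0) else none

end FreeBands

/-!
The word problem of the free band is solved by the Green–Rees theorem: nonempty words `u` and `v`
represent the same element if and only if `u ∗ β = v ∗ β` and `u ∘ β ∼ v ∘ β` for `β = 0, 1`;
equivalently, `f_u = f_v`. That `f_w` depends only on the class of `w` follows from
`f_{pwq} = f_{pwwq}` (`wordFun_square`); the converse holds because a word is equivalent to the
product of any prefix and any suffix that contain all its letters (`ofWord_eq_mul`).

Every factor of a short-lex least word is short-lex least (`IsLeast.factor`). So for `z = min(x)`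
the distinct words `z ∘ α` have distinct functions, and they are the states of a transducer
realizing `f_z`. Conversely, every transducer realizing `f_z` has a state for each of these
functions. The states `q` of the minimal transducer are therefore labelled bijectively by these
words `μ q` (`IsMinimalRepresenting.exists_isLabelling`). Such a word, unless it is `z` itself, is
determined by its number of letters, the position of one of its ends in `z`, and a bit, which bounds
the number of states by `1 + 2 (|z| + 1) |A|` (`IsLabelling.card_le`).

The word `z` begins with `min(x ∘ 0) (x ∗ 0)` and ends with `(x ∗ 1) min(x ∘ 1)`, and it is the
shortest word with this prefix and this suffix and without further letters, since all such words
represent `x` by the Green–Rees theorem. So the prefix and the suffix overlap if they can. If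
`x ∗ 0 ≠ x ∗ 1`, at most one overlap is possible, since its first letter is the last occurrence of
`x ∗ 1` in `min(x ∘ 0)`; this makes the search of `ClassifyCase` correct (`runs_classifyLoop`).

For `MinWord`, the invariant is that `B(q) = (i, j)` locates an occurrence of `μ q` in `w`, that the
domain of `B` is closed under transitions, and that the first `l` letters of `μ q`, which are
already present at the end of `w`, form the word `μ r` for a state `r` on the path `00⋯0` from `q`
at which `B` is defined (`runs_minWord`). A call either copies the missing letters, or defines `B`
at a new state after `O(|A|)` steps of its own and two further calls; this amortizes the time to
`O(|A| |Q| + |z|)`. The depth of the recursion is at most the number of letters of `z` plus one,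
which is at most `|Q|`.
-/

namespace FreeBands

/-! ### The operations `∘` and `∗` as factorizations -/

section Peel

variable {A : Type}

/-- `IsPeel w β a u` says that `u = w ∘ β` and `a = w ∗ β`, expressed as a factorization of `w`:
`w = u a g` (for `β = 0`) or `w = g a u` (for `β = 1`), where `a` does not occur in `u` and all
letters of `g` occur in `a u`. -/
def IsPeel (w : List A) : Fin 2 → A → List A → Prop
  | 0, a, u => ∃ g, w = u ++ a :: g ∧ a ∉ u ∧ g ⊆ a :: u
  | 1, a, u => ∃ g, w = g ++ a :: u ∧ a ∉ u ∧ g ⊆ a :: u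

theorem exists_isPeel {w : List A} (hw : w ≠ []) (β : Fin 2) : ∃ a u, IsPeel w β a u := by
  classical
  match β with
  | 0 =>
    induction w using List.reverseRecOn with
    | nil => exact absurd rfl hw
    | append_singleton w c ih =>
      by_cases hc : c ∈ w
      · obtain ⟨a, u, g, rfl, hau, hg⟩ := ih (List.ne_nil_of_mem hc)
        refine ⟨a, u, g ++ [c], by simp, hau, ?_⟩
        intro d hd
        rcases List.mem_append.1 hd with hd | hd
        · exact hg hd
        · rw [List.mem_singleton.1 hd]
          rcases List.mem_append.1 hc with hc | hc
          · exact List.mem_cons_of_mem _ hc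
          · rcases List.mem_cons.1 hc with rfl | hc
            · exact List.mem_cons_self
            · exact hg hc
      · exact ⟨c, w, [], rfl, hc, by simp⟩
  | 1 =>
    induction w with
    | nil => exact absurd rfl hw
    | cons c w ih =>
      by_cases hc : c ∈ w
      · obtain ⟨a, u, g, rfl, hau, hg⟩ := ih (List.ne_nil_of_mem hc)
        refine ⟨a, u, c :: g, by simp, hau, ?_⟩
        intro d hd
        rcases List.mem_cons.1 hd with rfl | hd
        · rcases List.mem_append.1 hc with hc | hc
          · exact hg hc
          · exact hc
        · exact hg hd
      · exact ⟨c, w, [], rfl, hc, by simp⟩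

theorem IsPeel.ne_nil {w : List A} {β : Fin 2} {a : A} {u : List A} (h : IsPeel w β a u) :
    w ≠ [] := by
  match β, h with
  | 0, ⟨g, hw, _, _⟩ => simp [hw]
  | 1, ⟨g, hw, _, _⟩ => simp [hw]

theorem IsPeel.notMem {w : List A} {β : Fin 2} {a : A} {u : List A} (h : IsPeel w β a u) :
    a ∉ u := by
  match β, h with
  | 0, ⟨g, _, h, _⟩ => exact h
  | 1, ⟨g, _, h, _⟩ => exact h

theorem IsPeel.mem_iff {w : List A} {β : Fin 2} {a : A} {u : List A} (h : IsPeel w β a u) (c : A) :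
    c ∈ w ↔ c = a ∨ c ∈ u := by
  match β, h with
  | 0, ⟨g, hw, _, hg⟩ =>
    have := @hg c
    simp only [hw, List.mem_append, List.mem_cons] at this ⊢
    tauto
  | 1, ⟨g, hw, _, hg⟩ =>
    have := @hg c
    simp only [hw, List.mem_append, List.mem_cons] at this ⊢
    tauto

theorem IsPeel.exists_append {w : List A} {β : Fin 2} {a : A} {u : List A} (h : IsPeel w β a u) :
    ∃ r s, w = r ++ u ++ s := by
  match β, h with
  | 0, ⟨g, hw, _, _⟩ => exact ⟨[], a :: g, by simpa using hw⟩
  | 1, ⟨g, hw, _, _⟩ => exact ⟨g ++ [a], [], by simpa using hw⟩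

theorem IsPeel.length_lt {w : List A} {β : Fin 2} {a : A} {u : List A} (h : IsPeel w β a u) :
    u.length < w.length := by
  match β, h with
  | 0, ⟨g, hw, _, _⟩ => simp [hw]
  | 1, ⟨g, hw, _, _⟩ => simp [hw]; omega

theorem isPeel_reverse {w : List A} {a : A} {u : List A} :
    IsPeel w.reverse 0 a u.reverse ↔ IsPeel w 1 a u := by
  constructor
  · rintro ⟨g, hw, ha, hg⟩
    refine ⟨g.reverse, ?_, by simpa using ha, fun c hc => by simpa using @hg c (by simpa using hc)⟩
    rw [← List.reverse_inj, hw]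
    simp
  · rintro ⟨g, hw, ha, hg⟩
    exact ⟨g.reverse, by simp [hw], by simpa using ha,
      fun c hc => by simpa using @hg c (by simpa using hc)⟩

/-- Squaring a factor `w` of a word does not change its `∗ 0`, and either does not change its `∘ 0`
or squares a factor `w` of it. -/
theorem isPeel_zero_square {p w q : List A} {a : A} {u : List A}
    (h : IsPeel (p ++ w ++ q) 0 a u) :
    ∃ v, IsPeel (p ++ (w ++ w) ++ q) 0 a v ∧
      (u = v ∨ ∃ p' q', u = p' ++ w ++ q' ∧ v = p' ++ (w ++ w) ++ q') := by
  have hmem : ∀ c, c ∈ p ++ (w ++ w) ++ q → c ∈ a :: u := fun c hc => by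
    have := (h.mem_iff c).1 (by simp only [List.mem_append] at hc ⊢; tauto)
    simpa using this
  obtain ⟨g, hw, ha, hg⟩ := h
  rw [List.append_assoc] at hw
  rcases List.append_eq_append_iff.1 hw with ⟨x, hx, hy⟩ | ⟨x, hx, hy⟩
  · -- the prefix `u` reaches beyond `p`
    rcases List.append_eq_append_iff.1 hy with ⟨y, hy', hz⟩ | ⟨y, hy', hz⟩
    · -- and beyond `w`
      refine ⟨p ++ (w ++ w) ++ y, ⟨g, by simp [hz], ?_, ?_⟩, .inr ⟨p, y, by simp [hx, hy'], rfl⟩⟩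
      · intro h
        apply ha
        simp only [hx, hy', List.mem_append] at h ⊢
        tauto
      · intro c hc
        have := hmem c (by simp [hz, hc])
        simp only [hx, hy', List.mem_append, List.mem_cons] at this ⊢
        tauto
    · cases y with
      | nil =>
        refine ⟨p ++ (w ++ w) , ⟨g, by simpa using hz.symm, ?_, ?_⟩,
          .inr ⟨p, [], by simpa [hx] using hy'.symm, by simp⟩⟩
        · intro h
          apply ha
          simp only [hx, hy', List.mem_append, List.append_nil] at h ⊢
          tauto
        · intro c hc
          have := hg hc
          simp only [hx, hy', List.mem_append, List.mem_cons, List.append_nil] at this ⊢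
          tauto
      | cons d y =>
        have hwx := hy'
        obtain ⟨rfl, rfl⟩ := List.cons.inj hz
        have e : p ++ (w ++ w) ++ q = u ++ a :: (y ++ w ++ q) := by
          nth_rw 1 [hwx]
          simp [hx]
        exact ⟨u, ⟨y ++ w ++ q, e, ha,
          fun c hc => hmem c (e ▸ by simp only [List.mem_append, List.mem_cons, hc]; tauto)⟩,
          .inl rfl⟩
  · cases x with
    | nil =>
      cases w with
      | nil => exact ⟨u, ⟨g, by simpa [hx] using hy.symm, ha, hg⟩, .inl rfl⟩
      | cons d w =>
        obtain ⟨rfl, rfl⟩ := List.cons.inj hy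
        refine ⟨u, ⟨w ++ a :: w ++ q, by simp [hx], ha, fun c hc => hmem c ?_⟩, .inl rfl⟩
        simp only [List.mem_append, List.mem_cons] at hc ⊢
        tauto
    | cons d x =>
      obtain ⟨rfl, rfl⟩ := List.cons.inj hy
      refine ⟨u, ⟨x ++ (w ++ w) ++ q, by simp [hx], ha, fun c hc => hmem c ?_⟩, .inl rfl⟩
      simp only [hx, List.mem_append, List.mem_cons] at hc ⊢
      tauto

theorem isPeel_square {p w q : List A} {β : Fin 2} {a : A} {u : List A}
    (h : IsPeel (p ++ w ++ q) β a u) :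
    ∃ v, IsPeel (p ++ (w ++ w) ++ q) β a v ∧
      (u = v ∨ ∃ p' q', u = p' ++ w ++ q' ∧ v = p' ++ (w ++ w) ++ q') := by
  match β with
  | 0 => exact isPeel_zero_square h
  | 1 =>
    rw [← isPeel_reverse] at h
    obtain ⟨v, hv, h'⟩ := isPeel_zero_square (p := q.reverse) (w := w.reverse) (q := p.reverse)
      (by simpa using h)
    refine ⟨v.reverse, isPeel_reverse.1 (by simpa using hv), ?_⟩
    rcases h' with h' | ⟨p', q', h1, h2⟩
    · left
      rw [← h', List.reverse_reverse]
    · right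
      refine ⟨q'.reverse, p'.reverse, ?_, by simp [h2]⟩
      rw [← List.reverse_inj, h1]
      simp

variable [DecidableEq A]

theorem contCard_eq_zero {w : List A} : contCard w = 0 ↔ w = [] := by
  simp [contCard]

theorem IsPeel.contCard {w : List A} {β : Fin 2} {a : A} {u : List A} (h : IsPeel w β a u) :
    contCard w = contCard u + 1 := by
  have : w.toFinset = insert a u.toFinset := by
    ext c
    simp [h.mem_iff c]
  rw [FreeBands.contCard, FreeBands.contCard, this, Finset.card_insert_of_notMem]
  simpa using h.notMem

theorem contCard_mono {u v : List A} (h : u ⊆ v) : contCard u ≤ contCard v := by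
  apply Finset.card_le_card
  intro c
  simpa using @h c

theorem contCard_lt {u v : List A} (h : u ⊆ v) {c : A} (hc : c ∈ v) (hc' : c ∉ u) :
    contCard u < contCard v := by
  apply Finset.card_lt_card
  refine Finset.ssubset_iff_of_subset (fun c => ?_) |>.2 ⟨c, ?_, ?_⟩
  · simpa using @h c
  · simpa using hc
  · simpa using hc'

/-- The search in the definition of `w ∘ 0` finds `u` for `w = u a g`. -/
theorem find?_inits_reverse (u g : List A) (a : A) (ha : a ∉ u) (hg : g ⊆ a :: u) :
    (u ++ a :: g).inits.reverse.find? (fun v => contCard v + 1 = contCard (u ++ [a])) =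
      some u := by
  induction g using List.reverseRecOn with
  | nil =>
    have h := IsPeel.contCard (w := u ++ [a]) (β := 0) ⟨[], rfl, ha, by simp⟩
    have e : (u ++ [a]).inits.reverse = (u ++ [a]) :: u.inits.reverse := by
      simp [List.inits_append]
    rw [e, List.find?_cons_of_neg (by simp)]
    cases u using List.reverseRecOn with
    | nil => simpa using h.symm
    | append_singleton u c =>
      have e : (u ++ [c]).inits.reverse = (u ++ [c]) :: u.inits.reverse := by
        simp [List.inits_append]
      rw [e, List.find?_cons_of_pos]
      simpa using h.symm
  | append_singleton g c ih =>
    have e : (u ++ a :: (g ++ [c])).inits.reverse =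
        (u ++ a :: (g ++ [c])) :: (u ++ a :: g).inits.reverse := by
      have : u ++ a :: (g ++ [c]) = (u ++ a :: g) ++ [c] := by simp
      rw [this, List.inits_append]
      simp
    rw [e, List.find?_cons_of_neg, ih fun d hd => hg (by simp [hd])]
    have : contCard (u ++ [a]) ≤ contCard (u ++ a :: (g ++ [c])) :=
      contCard_mono fun d => by simp; tauto
    simp only [decide_eq_true_eq]
    omega

/-- The search in the definition of `w ∘ 1` finds `u` for `w = g a u`. -/
theorem find?_tails (u g : List A) (a : A) (ha : a ∉ u) (hg : g ⊆ a :: u) :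
    (g ++ a :: u).tails.find? (fun v => contCard v + 1 = contCard (a :: u)) = some u := by
  induction g with
  | nil =>
    have h := IsPeel.contCard (w := a :: u) (β := 1) ⟨[], rfl, ha, by simp⟩
    rw [List.nil_append, List.tails_cons, List.find?_cons_of_neg (by simp)]
    cases u with
    | nil => simpa using h.symm
    | cons c u =>
      rw [List.tails_cons, List.find?_cons_of_pos]
      simpa using h.symm
  | cons c g ih =>
    rw [List.cons_append, List.tails_cons, List.find?_cons_of_neg, ih fun d hd => hg (by simp [hd])]
    have : contCard (a :: u) ≤ contCard (c :: (g ++ a :: u)) :=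
      contCard_mono fun d => by simp; tauto
    simp only [decide_eq_true_eq]
    omega

theorem IsPeel.circ {w : List A} {β : Fin 2} {a : A} {u : List A} (h : IsPeel w β a u) :
    circ w β = some u := by
  match β, h with
  | 0, ⟨g, hw, ha, hg⟩ =>
    have h0 : FreeBands.contCard w = FreeBands.contCard (u ++ [a]) :=
      le_antisymm (contCard_mono fun c hc => by
          have := @hg c
          simp only [hw, List.mem_append, List.mem_cons, List.not_mem_nil] at this hc ⊢
          tauto) (contCard_mono fun c => by simp [hw]; tauto)
    rw [FreeBands.circ, h0, hw]
    exact find?_inits_reverse u g a ha hg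
  | 1, ⟨g, hw, ha, hg⟩ =>
    have h0 : FreeBands.contCard w = FreeBands.contCard (a :: u) :=
      le_antisymm (contCard_mono fun c hc => by
          have := @hg c
          simp only [hw, List.mem_append, List.mem_cons] at this hc ⊢
          tauto) (contCard_mono fun c => by simp [hw]; tauto)
    rw [FreeBands.circ, h0, hw]
    exact find?_tails u g a ha hg

theorem IsPeel.star {w : List A} {β : Fin 2} {a : A} {u : List A} (h : IsPeel w β a u) :
    star w β = some a := by
  have hc := h.circ
  match β, h with
  | 0, ⟨g, hw, _, _⟩ =>
    rw [FreeBands.star, hc]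
    simp [hw]
  | 1, ⟨g, hw, _, _⟩ =>
    rw [FreeBands.star, hc]
    have : w.length - u.length - 1 = g.length := by
      rw [hw, List.length_append, List.length_cons]
      omega
    rw [Option.bind_some, this, hw]
    simp

/-! ### The functions `f_w` -/

theorem wordFun_nil_cons (β : Fin 2) (γ : List (Fin 2)) :
    wordFun ([] : List A) (β :: γ) = none := by
  match β with
  | 0 => simp [wordFun, star, circ, contCard]
  | 1 => simp [wordFun, star, circ, contCard]

theorem wordFun_nil {w : List A} (hw : w ≠ []) : wordFun w [] = none := by
  cases w with
  | nil => exact absurd rfl hw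
  | cons a w => rfl

theorem IsPeel.wordFun_cons {w : List A} {β : Fin 2} {a : A} {u : List A} (h : IsPeel w β a u)
    (γ : List (Fin 2)) : wordFun w (β :: γ) = (wordFun u γ).map (a :: ·) := by
  have : wordFun w (β :: γ) = (do
      let a ← FreeBands.star w β
      let u ← FreeBands.circ w β
      let r ← wordFun u γ
      return a :: r) := by
    cases w <;> rfl
  rw [this, h.star, h.circ]
  cases h' : wordFun u γ <;> simp [h']

theorem exists_wordFun_eq_some (w : List A) : ∃ γ r, wordFun w γ = some r := by
  by_cases hw : w = []
  · exact ⟨[], [], by subst hw; rfl⟩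
  · obtain ⟨a, u, h⟩ := exists_isPeel hw 0
    have := h.length_lt
    obtain ⟨γ, r, hr⟩ := exists_wordFun_eq_some u
    exact ⟨0 :: γ, a :: r, by rw [h.wordFun_cons, hr]; rfl⟩
termination_by w.length

theorem eq_nil_of_wordFun_eq {w : List A} (h : wordFun w = wordFun []) : w = [] := by
  by_contra hw
  have := congrFun h []
  rw [wordFun_nil hw] at this
  exact absurd this (by simp [wordFun])

/-- Equal functions `f_u` and `f_v` determine equal letters `u ∗ β = v ∗ β` and equal functions of
`u ∘ β` and `v ∘ β`: the domain of every `f_w` is nonempty, so no information is lost. -/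
theorem IsPeel.of_wordFun_eq {u v : List A} {β : Fin 2} {a b : A} {u' v' : List A}
    (hu : IsPeel u β a u') (hv : IsPeel v β b v') (h : wordFun u = wordFun v) :
    a = b ∧ wordFun u' = wordFun v' := by
  have key : ∀ γ, (wordFun u' γ).map (a :: ·) = (wordFun v' γ).map (b :: ·) := fun γ => by
    rw [← hu.wordFun_cons, ← hv.wordFun_cons, h]
  obtain ⟨γ, r, hr⟩ := exists_wordFun_eq_some u'
  have hab : a = b := by
    have := key γ
    rw [hr] at this
    cases h' : wordFun v' γ with
    | none => simp [h'] at this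
    | some s =>
      simp only [h', Option.map_some, Option.some.injEq, List.cons.injEq] at this
      exact this.1
  subst hab
  exact ⟨rfl, funext fun γ => Option.map_injective (List.cons_injective) (key γ)⟩

theorem wordFun_eq_of_isPeel {u v : List A} {a : Fin 2 → A} {u' v' : Fin 2 → List A}
    (hu : ∀ β, IsPeel u β (a β) (u' β)) (hv : ∀ β, IsPeel v β (a β) (v' β))
    (h : ∀ β, wordFun (u' β) = wordFun (v' β)) : wordFun u = wordFun v := by
  funext γ
  cases γ with
  | nil => rw [wordFun_nil (hu 0).ne_nil, wordFun_nil (hv 0).ne_nil]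
  | cons β γ => rw [(hu β).wordFun_cons, (hv β).wordFun_cons, h β]

/-! ### The word problem of the free band -/

/-- The function `f` is invariant under squaring a factor, by induction on the length: peeling off
a letter leaves equal words or words that again differ by squaring a factor. -/
theorem wordFun_square (p w q : List A) :
    wordFun (p ++ w ++ q) = wordFun (p ++ (w ++ w) ++ q) := by
  by_cases hn : p ++ w ++ q = []
  · simp only [List.append_eq_nil_iff] at hn
    simp [hn]
  · choose a u hu using exists_isPeel hn
    choose v hv h using fun β => isPeel_square (hu β)
    refine wordFun_eq_of_isPeel hu hv fun β => ?_
    rcases h β with h | ⟨p', q', h1, h2⟩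
    · rw [h]
    · have hlt := (hu β).length_lt
      rw [h1, h2]
      exact wordFun_square p' w q'
termination_by (p ++ w ++ q).length
decreasing_by
  rw [← h1]
  exact hlt

end Peel

section Band

variable {A : Type}

theorem ofWord_append (u v : List A) :
    FreeBand.ofWord (u ++ v) = FreeBand.ofWord u * FreeBand.ofWord v := rfl

theorem exists_ofWord (x : FreeBand A) : ∃ w, FreeBand.ofWord w = x := by
  induction x using Con.induction_on with
  | H w => exact ⟨FreeMonoid.toList w, rfl⟩

theorem freeBand_mul_self (x : FreeBand A) : x * x = x := by
  obtain ⟨w, rfl⟩ := exists_ofWord x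
  exact ((Con.eq (bandCon A)).2
    (ConGen.Rel.of (FreeMonoid.ofList w) (FreeMonoid.ofList (w ++ w)) rfl)).symm

/-- A function on words that is invariant under squaring a factor is a function on the free band:
the words that can be exchanged in all contexts without changing its value form a congruence
containing all pairs `(w, w²)`. -/
theorem eq_of_ofWord_eq {β : Type} (f : List A → β)
    (hf : ∀ p w q, f (p ++ w ++ q) = f (p ++ (w ++ w) ++ q)) {u v : List A}
    (h : FreeBand.ofWord u = FreeBand.ofWord v) : f u = f v := by
  let c : Con (FreeMonoid A) :=
    { r := fun u v => ∀ p q, f (p ++ u.toList ++ q) = f (p ++ v.toList ++ q)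
      iseqv := ⟨fun _ _ _ => rfl, fun h p q => (h p q).symm,
        fun h h' p q => (h p q).trans (h' p q)⟩
      mul' := by
        intro u v u' v' h h' p q
        have h1 := h p (u'.toList ++ q)
        have h2 := h' (p ++ v.toList) q
        simp only [FreeMonoid.toList_mul, List.append_assoc] at h1 h2 ⊢
        rw [h1, h2] }
  have hle : bandCon A ≤ c := by
    refine Con.conGen_le.2 ?_
    rintro u v rfl p q
    have := hf p (FreeMonoid.toList u) q
    simpa only [FreeMonoid.toList_mul] using this
  have := hle ((Con.eq _).1 h) [] []
  simpa using this

theorem mem_iff_of_ofWord_eq {u v : List A} (h : FreeBand.ofWord u = FreeBand.ofWord v) (c : A) :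
    c ∈ u ↔ c ∈ v := by
  refine iff_of_eq (eq_of_ofWord_eq (fun w => c ∈ w) (fun p w q => ?_) h)
  simp

theorem wordFun_eq_of_ofWord_eq [DecidableEq A] {u v : List A}
    (h : FreeBand.ofWord u = FreeBand.ofWord v) : wordFun u = wordFun v :=
  eq_of_ofWord_eq wordFun wordFun_square h

/-- If all letters of `y` occur in `x`, then `x` and `x y` generate the same right ideal. -/
theorem exists_append_eq {x y : List A} (h : y ⊆ x) :
    ∃ e, e ⊆ x ∧ FreeBand.ofWord x = FreeBand.ofWord (x ++ y ++ e) := by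
  induction y using List.reverseRecOn with
  | nil =>
    exact ⟨[], by simp, by simp⟩
  | append_singleton y c ih =>
    have hy : y ⊆ x := fun d hd => h (by simp [hd])
    obtain ⟨e, he, hxe⟩ := ih hy
    have hc : c ∈ x ++ y := by
      simp [h (show c ∈ y ++ [c] by simp)]
    obtain ⟨z₁, z₂, hz⟩ := List.append_of_mem hc
    refine ⟨z₂ ++ e, fun d hd => ?_, ?_⟩
    · rcases List.mem_append.1 hd with hd | hd
      · have : d ∈ x ++ y := by simp [hz, hd]
        rcases List.mem_append.1 this with hd | hd
        · exact hd
        · exact hy hd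
      · exact he hd
    · -- `x y = z₁ c z₂ ∼ z₁ (c z₂) (c z₂) = x y c z₂`
      have h1 : FreeBand.ofWord (x ++ y) = FreeBand.ofWord (x ++ y ++ c :: z₂) := by
        rw [ofWord_append (x ++ y), hz, ofWord_append z₁, mul_assoc, freeBand_mul_self]
      have h2 : x ++ (y ++ [c]) ++ (z₂ ++ e) = (x ++ y ++ c :: z₂) ++ e := by simp
      rw [h2, ofWord_append, ← h1, ← ofWord_append, hxe]

/-- Equivalence of words is invariant under reversal of words, so one-sided statements dualize. -/
theorem ofWord_reverse_eq {u v : List A} (h : FreeBand.ofWord u = FreeBand.ofWord v) :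
    FreeBand.ofWord u.reverse = FreeBand.ofWord v.reverse :=
  eq_of_ofWord_eq (fun w => FreeBand.ofWord w.reverse) (fun p w q => by
    simp only [List.reverse_append, ofWord_append, freeBand_mul_self]) h

theorem exists_append_eq_left {x y : List A} (h : y ⊆ x) :
    ∃ e, e ⊆ x ∧ FreeBand.ofWord x = FreeBand.ofWord (e ++ y ++ x) := by
  obtain ⟨e, he, h'⟩ := exists_append_eq (x := x.reverse) (y := y.reverse)
    (fun c hc => by simpa using @h c (by simpa using hc))
  refine ⟨e.reverse, fun c hc => by simpa using @he c (by simpa using hc), ?_⟩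
  simpa using ofWord_reverse_eq h'

/-- If all letters of `y` occur in `x`, then `x y x ∼ x`. -/
theorem ofWord_append_append_self {x y : List A} (h : y ⊆ x) :
    FreeBand.ofWord (x ++ y ++ x) = FreeBand.ofWord x := by
  obtain ⟨e, -, he⟩ := exists_append_eq h
  -- `x = x y e`, hence `x y x = (x y)² e = x y e = x`
  simp only [ofWord_append] at he ⊢
  conv_lhs => rw [he]
  rw [← he]
  conv_rhs => rw [he]
  conv_lhs => arg 2; rw [he]
  rw [← mul_assoc, freeBand_mul_self]

/-- A word is equivalent to the product of a prefix and a suffix that contain all its letters. -/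
theorem ofWord_eq_mul {p g h s : List A} (e : p ++ g = h ++ s) (hg : g ⊆ p) (hh : h ⊆ s) :
    FreeBand.ofWord (p ++ g) = FreeBand.ofWord (p ++ s) := by
  obtain ⟨e₁, he₁, h₁⟩ := exists_append_eq hg
  obtain ⟨e₂, he₂, h₂⟩ := exists_append_eq_left hh
  have h3 : FreeBand.ofWord (p ++ s) = FreeBand.ofWord (p ++ g ++ (e₁ ++ e₂) ++ (p ++ g)) := by
    rw [ofWord_append p s, h₁, h₂, List.append_assoc e₂, ← e]
    simp only [ofWord_append, mul_assoc]
  rw [h3, ofWord_append_append_self]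
  intro c hc
  rcases List.mem_append.1 hc with hc | hc
  · simp [he₁ hc]
  · rw [e]
    simp [he₂ hc]

/-- The Green–Rees decomposition: `w ∼ (w ∘ 0)(w ∗ 0)(w ∗ 1)(w ∘ 1)`. -/
theorem ofWord_eq_of_isPeel {w : List A} {a b : A} {p s : List A} (hp : IsPeel w 0 a p)
    (hs : IsPeel w 1 b s) : FreeBand.ofWord w = FreeBand.ofWord (p ++ [a] ++ (b :: s)) := by
  obtain ⟨g, hw, -, hg⟩ := hp
  obtain ⟨h, hw', -, hh⟩ := hs
  rw [← ofWord_eq_mul (g := g) (h := h) (by rw [← hw', hw]; simp) _ hh, hw]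
  · simp
  · intro c hc
    have := hg hc
    simp only [List.mem_cons, List.mem_append, List.not_mem_nil] at this ⊢
    tauto

/-- The solution of the word problem: words with the same function represent the same element. -/
theorem ofWord_eq_of_wordFun_eq [DecidableEq A] {u v : List A} (h : wordFun u = wordFun v) :
    FreeBand.ofWord u = FreeBand.ofWord v := by
  by_cases hu : u = []
  · subst hu
    rw [eq_nil_of_wordFun_eq h.symm]
  · have hv : v ≠ [] := by
      rintro rfl
      exact hu (eq_nil_of_wordFun_eq h)
    obtain ⟨a, p, hp⟩ := exists_isPeel hu 0
    obtain ⟨b, s, hs⟩ := exists_isPeel hu 1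
    obtain ⟨a', p', hp'⟩ := exists_isPeel hv 0
    obtain ⟨b', s', hs'⟩ := exists_isPeel hv 1
    obtain ⟨rfl, h0⟩ := hp.of_wordFun_eq hp' h
    obtain ⟨rfl, h1⟩ := hs.of_wordFun_eq hs' h
    have := hp.length_lt
    have := hs.length_lt
    have h0 := ofWord_eq_of_wordFun_eq h0
    have h1 := ofWord_eq_of_wordFun_eq h1
    rw [ofWord_eq_of_isPeel hp hs, ofWord_eq_of_isPeel hp' hs',
      ← List.singleton_append (l := s), ← List.singleton_append (l := s')]
    simp only [ofWord_append, h0, h1]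
termination_by u.length

end Band

/-! ### Overlaps -/

section Overlaps

variable {A : Type}

/-- Any continuation of `(z ∘ 0)(z ∗ 0)` by letters of `z` has the same peeling at `0` as `z`. -/
theorem isPeel_zero_append {z g : List A} {a : A} {p : List A} (hp : IsPeel z 0 a p)
    (hg : g ⊆ z) : IsPeel (p ++ a :: g) 0 a p :=
  ⟨g, rfl, hp.notMem, fun c hc => by simpa using (hp.mem_iff c).1 (hg hc)⟩

/-- Any word of letters of `z` followed by `(z ∗ 1)(z ∘ 1)` has the same peeling at `1` as `z`. -/
theorem isPeel_one_append {z g : List A} {a : A} {s : List A} (hs : IsPeel z 1 a s)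
    (hg : g ⊆ z) : IsPeel (g ++ a :: s) 1 a s :=
  ⟨g, rfl, hs.notMem, fun c hc => by simpa using (hs.mem_iff c).1 (hg hc)⟩

theorem IsPeel.subset {w : List A} {β : Fin 2} {a : A} {u : List A} (h : IsPeel w β a u) :
    u ⊆ w := fun c hc => (h.mem_iff c).2 (.inr hc)

theorem IsPeel.mem {w : List A} {β : Fin 2} {a : A} {u : List A} (h : IsPeel w β a u) :
    a ∈ w := (h.mem_iff a).2 (.inl rfl)

/-- The prefix `(z ∘ 0)(z ∗ 0)` and the suffix `(z ∗ 1)(z ∘ 1)` of a word `z` overlap in one letter,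
or in a longer word, or not at all. -/
theorem isPeel_cases {z : List A} {a b : A} {p s : List A} (hp : IsPeel z 0 a p)
    (hs : IsPeel z 1 b s) :
    (a = b ∧ z = p ++ a :: s) ∨
      (a ≠ b ∧ ∃ p' t s', p = p' ++ b :: t ∧ s = t ++ a :: s' ∧ z = p ++ a :: s') ∨
      ∃ m, z = p ++ a :: (m ++ b :: s) := by
  have ha := hp.notMem
  have hb := hs.notMem
  obtain ⟨g, hz, -, -⟩ := hp
  obtain ⟨h, hz', -, -⟩ := hs
  rcases List.append_eq_append_iff.1 (hz.symm.trans hz') with ⟨x, hx, hy⟩ | ⟨x, hx, hy⟩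
  · cases x with
    | nil =>
      obtain ⟨rfl, rfl⟩ := List.cons.inj hy
      exact .inl ⟨rfl, hz⟩
    | cons c x =>
      obtain ⟨rfl, rfl⟩ := List.cons.inj hy
      exact .inr (.inr ⟨x, hz⟩)
  · cases x with
    | nil =>
      obtain ⟨rfl, rfl⟩ := List.cons.inj hy
      exact .inl ⟨rfl, hz⟩
    | cons c x =>
      obtain ⟨rfl, rfl⟩ := List.cons.inj hy
      refine .inr (.inl ⟨fun h => ha ?_, h, x, g, hx, rfl, hz⟩)
      simp [hx, h]

/-- The last occurrence of a letter in a word is unique. -/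
theorem append_cons_inj {u v u' v' : List A} {b : A} (h : u ++ b :: v = u' ++ b :: v')
    (hv : b ∉ v) (hv' : b ∉ v') : u = u' ∧ v = v' := by
  rcases List.append_eq_append_iff.1 h with ⟨x, hx, hy⟩ | ⟨x, hx, hy⟩ <;> cases x with
    | nil => simp_all
    | cons c x =>
      obtain ⟨rfl, rfl⟩ := List.cons.inj hy
      simp at hv hv'

end Overlaps

/-! ### Short-lex least words -/

section MinWords

theorem finite_setOf_length_eq {A : Type} (s : Finset A) (n : ℕ) :
    {w : List A | w.length = n ∧ ∀ c ∈ w, c ∈ s}.Finite := by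
  refine ((List.finite_length_eq s n).image (List.map Subtype.val)).subset ?_
  rintro w ⟨hn, hs⟩
  exact ⟨w.attach.map fun c => ⟨c.1, hs _ c.2⟩, by simpa using hn, by simp⟩

variable {A : Type} [LinearOrder A]

/-- The short-lex least word exists although the alphabet need not be well ordered: words that
represent the same element have the same letters. -/
theorem exists_isMinWord (x : FreeBand A) : ∃ z, IsMinWord x z := by
  classical
  obtain ⟨w, hw⟩ := exists_ofWord x
  have hex : ∃ n, ∃ v : List A, v.length = n ∧ FreeBand.ofWord v = x := ⟨_, w, rfl, hw⟩
  let n := Nat.find hex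
  let S := {v : List A | v.length = n ∧ FreeBand.ofWord v = x}
  have hS : S.Finite := by
    refine (finite_setOf_length_eq w.toFinset n).subset fun v hv => ⟨hv.1, fun c hc => ?_⟩
    simpa using (mem_iff_of_ofWord_eq (hv.2.trans hw.symm) c).1 hc
  obtain ⟨z, hz, hmin⟩ := Set.exists_min_image S id hS (Nat.find_spec hex)
  refine ⟨z, hz.2, fun v hv => ?_⟩
  rcases (Nat.find_min' hex ⟨v, rfl, hv⟩).lt_or_eq with h | h
  · exact .inr (.of_length_lt (hz.1.trans_lt h))
  · rcases (hmin v ⟨h.symm, hv⟩).eq_or_lt with h' | h'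
    · exact .inl h'.symm
    · exact .inr (.of_lex (hz.1.trans h) ((List.lt_iff_lex_lt _ _).1 h'))

theorem IsMinWord.unique {x : FreeBand A} {u v : List A} (hu : IsMinWord x u)
    (hv : IsMinWord x v) : u = v := by
  rcases hu.2 v hv.1 with h | h
  · exact h.symm
  · rcases hv.2 u hu.1 with h' | h'
    · exact h'
    · exact absurd h (asymm h')

theorem IsMinWord.length_le {x : FreeBand A} {u v : List A} (hu : IsMinWord x u)
    (hv : FreeBand.ofWord v = x) : u.length ≤ v.length := by
  rcases hu.2 v hv with rfl | h
  · exact le_rfl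
  · rcases List.shortlex_def.1 h with h | h <;> omega

theorem shortlex_append_right {u v : List A} (h : List.Shortlex (· < ·) u v) (s : List A) :
    List.Shortlex (· < ·) (u ++ s) (v ++ s) := by
  rcases List.shortlex_def.1 h with hl | ⟨hl, h'⟩
  · exact .of_length_lt (by simpa using hl)
  · refine .of_lex (by simpa using hl) ?_
    clear h
    induction h' with
    | nil => simp at hl
    | cons _ ih => exact .cons (ih (by simpa using hl))
    | rel h => exact .rel h

/-- The word `z` is the short-lex least word representing some element of the free band. -/
def IsLeast (z : List A) : Prop := IsMinWord (FreeBand.ofWord z) z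

/-- Factors of short-lex least words are short-lex least: otherwise the factor could be replaced by
a smaller word. -/
theorem IsLeast.factor {r t s : List A} (h : IsLeast (r ++ t ++ s)) : IsLeast t := by
  refine ⟨rfl, fun v hv => ?_⟩
  have hv' : FreeBand.ofWord (r ++ v ++ s) = FreeBand.ofWord (r ++ t ++ s) := by
    simp only [ofWord_append, hv]
  by_cases e : v = t
  · exact .inl e
  by_cases h' : List.Shortlex (· < ·) t v
  · exact .inr h'
  have h'' : List.Shortlex (· < ·) v t := by
    by_contra h''
    exact e (Std.Trichotomous.trichotomous (r := List.Shortlex (· < ·)) _ _ h'' h')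
  have h3 := shortlex_append_right (h''.append_left r) s
  rcases h.2 _ hv' with h4 | h4
  · rw [h4] at h3
    exact absurd h3 (asymm h3)
  · exact absurd h3 (asymm h4)

theorem IsLeast.peel {z : List A} (h : IsLeast z) {β : Fin 2} {a : A} {u : List A}
    (hu : IsPeel z β a u) : IsLeast u := by
  obtain ⟨r, s, rfl⟩ := hu.exists_append
  exact h.factor

theorem IsLeast.eq_of_ofWord_eq {u v : List A} (hu : IsLeast u) (hv : IsLeast v)
    (h : FreeBand.ofWord u = FreeBand.ofWord v) : u = v := by
  refine hu.unique (x := FreeBand.ofWord u) ?_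
  rw [h]
  exact hv

/-- A word with the prefix `p a` and the suffix `b s` of `z`, and no further letters, represents the
same element as `z`, hence it is not shorter. -/
theorem IsLeast.length_le {z y : List A} (hz : IsLeast z) {a b : A} {p s : List A}
    (hp : IsPeel z 0 a p) (hs : IsPeel z 1 b s) (hp' : IsPeel y 0 a p) (hs' : IsPeel y 1 b s) :
    z.length ≤ y.length :=
  IsMinWord.length_le hz (by rw [ofWord_eq_of_isPeel hp hs, ofWord_eq_of_isPeel hp' hs'])

theorem IsLeast.eq_of_eq {z : List A} (hz : IsLeast z) {a : A} {p s : List A}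
    (hp : IsPeel z 0 a p) (hs : IsPeel z 1 a s) : z = p ++ a :: s := by
  have hlen := hz.length_le hp hs (isPeel_zero_append hp hs.subset)
    (isPeel_one_append hs hp.subset)
  rcases isPeel_cases hp hs with h | h | ⟨m, h⟩
  · exact h.2
  · exact absurd rfl h.1
  · have := congrArg List.length h
    simp at this hlen
    omega

theorem IsLeast.eq_of_overlap {z : List A} (hz : IsLeast z) {a b : A} {p s p' t s' : List A}
    (hp : IsPeel z 0 a p) (hs : IsPeel z 1 b s) (hab : a ≠ b) (hpt : p = p' ++ b :: t)
    (hst : s = t ++ a :: s') : z = p ++ a :: s' := by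
  have hbt : b ∉ t := fun h => hs.notMem (by simp [hst, h])
  have hlen := hz.length_le (y := p ++ a :: s') hp hs
    (isPeel_zero_append hp fun c hc => hs.subset (by simp [hst, hc])) (by
      have : p ++ a :: s' = p' ++ b :: s := by simp [hpt, hst]
      rw [this]
      exact isPeel_one_append hs fun c hc => hp.subset (by simp [hpt, hc]))
  rcases isPeel_cases hp hs with h | ⟨-, p₁, t₁, s₁, h1, h2, h3⟩ | ⟨m, h⟩
  · exact absurd h.1 hab
  · obtain ⟨-, rfl⟩ := append_cons_inj (hpt.symm.trans h1) hbt
      (fun h => hs.notMem (by simp [h2, h]))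
    rw [hst] at h2
    simp only [List.append_cancel_left_eq, List.cons.injEq, true_and] at h2
    rw [h3, h2]
  · have := congrArg List.length h
    simp [hst] at this hlen
    omega

theorem IsLeast.eq_of_not_overlap {z : List A} (hz : IsLeast z) {a b : A} {p s : List A}
    (hp : IsPeel z 0 a p) (hs : IsPeel z 1 b s) (hab : a ≠ b)
    (h : ∀ p' t s', p = p' ++ b :: t → s ≠ t ++ a :: s') : z = p ++ a :: b :: s := by
  have hlen := hz.length_le (y := p ++ a :: b :: s) hp hs
    (isPeel_zero_append hp fun c hc => by
      rcases List.mem_cons.1 hc with rfl | hc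
      · exact hs.mem
      · exact hs.subset hc) (by
      have : p ++ a :: b :: s = (p ++ [a]) ++ b :: s := by simp
      rw [this]
      refine isPeel_one_append hs fun c hc => ?_
      rcases List.mem_append.1 hc with hc | hc
      · exact hp.subset hc
      · rw [List.mem_singleton.1 hc]
        exact hp.mem)
  rcases isPeel_cases hp hs with h' | ⟨-, p₁, t₁, s₁, h1, h2, h3⟩ | ⟨m, h'⟩
  · exact absurd h'.1 hab
  · exact absurd h2 (h _ _ _ h1)
  · have := congrArg List.length h'
    simp at this hlen
    have hm : m = [] := List.eq_nil_of_length_eq_zero (by omega)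
    rw [h', hm]
    rfl

end MinWords

/-! ### The states of the minimal transducer -/

namespace Transducer

section AccFun

variable {Q S G : Type}

open Classical in
/-- The partial function realized by `T` when started in the state `q`. -/
noncomputable def accFun (T : Transducer Q S G) (q : Q) (γ : List S) : Option (List G) :=
  if ∃ p ∈ T.terminal, T.nextWord q γ = some p then T.outWord q γ else none

theorem realizes_iff {T : Transducer Q S G} {f : List S → Option (List G)} :
    T.Realizes f ↔ f = T.accFun T.init := by
  constructor
  · rintro ⟨h, h'⟩
    funext α
    rw [accFun]
    split_ifs with hα
    · exact h α hα
    · exact h' α hα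
  · rintro rfl
    exact ⟨fun α hα => if_pos hα, fun α hα => if_neg hα⟩

theorem accFun_nil_eq_some {T : Transducer Q S G} {q : Q} :
    T.accFun q [] = some [] ↔ q ∈ T.terminal := by
  have : (∃ p ∈ T.terminal, T.nextWord q [] = some p) ↔ q ∈ T.terminal := by
    simp [nextWord]
  rw [accFun, this, outWord]
  simp

theorem accFun_nil_of_notMem {T : Transducer Q S G} {q : Q} (h : q ∉ T.terminal) :
    T.accFun q [] = none := by
  rw [accFun, if_neg]
  simpa [nextWord] using h

theorem accFun_cons {T : Transducer Q S G} {q p : Q} {β : S} {a : G} (hp : T.next q β = some p)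
    (ha : T.out q β = some a) (γ : List S) :
    T.accFun q (β :: γ) = (T.accFun p γ).map (a :: ·) := by
  have : T.nextWord q (β :: γ) = T.nextWord p γ := by
    rw [nextWord, hp, Option.bind_some]
  rw [accFun, accFun, this]
  split_ifs with h
  · rw [outWord, ha, hp]
    cases h' : T.outWord p γ <;> simp [h']
  · rfl

theorem accFun_cons_of_eq_none {T : Transducer Q S G} {q : Q} {β : S} (h : T.next q β = none)
    (γ : List S) : T.accFun q (β :: γ) = none := by
  rw [accFun, if_neg]
  simp [nextWord, h]

end AccFun

section Canonical

variable {A : Type}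

/-- `PeelsTo z u` says that `u = z ∘ α` for some word `α` over `{0, 1}`. -/
inductive PeelsTo (z : List A) : List A → Prop
  | refl : PeelsTo z z
  | step {w u : List A} {β : Fin 2} {a : A} : PeelsTo z w → IsPeel w β a u → PeelsTo z u

theorem PeelsTo.eq_or {z u : List A} (h : PeelsTo z u) :
    u = z ∨ ∃ w β a, PeelsTo z w ∧ IsPeel w β a u := by
  cases h with
  | refl => exact .inl rfl
  | step h h' => exact .inr ⟨_, _, _, h, h'⟩

theorem PeelsTo.exists_append {z u : List A} (h : PeelsTo z u) : ∃ r s, z = r ++ u ++ s := by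
  induction h with
  | refl => exact ⟨[], [], by simp⟩
  | step _ h ih =>
    obtain ⟨r, s, hz⟩ := ih
    obtain ⟨r', s', hw⟩ := h.exists_append
    exact ⟨r ++ r', s' ++ s, by simp [hz, hw]⟩

theorem PeelsTo.nil {z u : List A} (h : PeelsTo z u) : PeelsTo z [] := by
  by_cases hu : u = []
  · rwa [hu] at h
  · obtain ⟨a, v, hv⟩ := exists_isPeel hu 0
    have := hv.length_lt
    exact (h.step hv).nil
termination_by u.length

theorem finite_peelsTo (z : List A) : Finite {u // PeelsTo z u} := by
  refine (List.finite_toSet z.sublists).subset fun u hu => ?_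
  obtain ⟨r, s, rfl⟩ := PeelsTo.exists_append hu
  simp only [Set.mem_ofPred_eq, List.mem_sublists]
  exact (List.sublist_append_right r u).trans (List.sublist_append_left _ s)

open Classical in
/-- The transducer with the words `z ∘ α` as its states. -/
noncomputable def canonical (z : List A) : Transducer {u // PeelsTo z u} (Fin 2) A where
  init := ⟨z, .refl⟩
  terminal := {u | u.1 = []}
  terminal_nonempty := ⟨⟨[], PeelsTo.refl.nil⟩, rfl⟩
  next u β := if h : u.1 = [] then none else
    some ⟨(exists_isPeel h β).choose_spec.choose,
      u.2.step (exists_isPeel h β).choose_spec.choose_spec⟩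
  out u β := if h : u.1 = [] then none else some (exists_isPeel h β).choose
  next_isSome_iff u β := by split_ifs <;> simp

theorem accFun_canonical [DecidableEq A] (z : List A) (u : {u // PeelsTo z u}) :
    (canonical z).accFun u = wordFun u.1 := by
  funext γ
  induction γ generalizing u with
  | nil =>
    by_cases h : u.1 = []
    · rw [h, wordFun]
      exact accFun_nil_eq_some.2 h
    · rw [wordFun_nil h]
      exact accFun_nil_of_notMem h
  | cons β γ ih =>
    by_cases h : u.1 = []
    · rw [h, wordFun_nil_cons]
      exact accFun_cons_of_eq_none (dif_pos h) _
    · rw [accFun_cons (dif_neg h) (dif_neg h), ih,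
        (exists_isPeel h β).choose_spec.choose_spec.wordFun_cons]

end Canonical

section Labelling

variable {A : Type} [LinearOrder A] {Q : Type}

/-- The states `q` of `T` correspond to the short-lex least words `μ q` of the elements that they
represent, and the transitions of `T` to the operations `∘` and `∗` on these words. -/
structure IsLabelling (T : Transducer Q (Fin 2) A) (μ : Q → List A) : Prop where
  least : ∀ q, IsLeast (μ q)
  injective : Function.Injective μ
  terminal : ∀ q, q ∈ T.terminal ↔ μ q = []
  step : ∀ q β, μ q ≠ [] →
    ∃ a p, T.next q β = some p ∧ T.out q β = some a ∧ IsPeel (μ q) β a (μ p)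
  next_eq_none : ∀ q β, μ q = [] → T.next q β = none
  peelsTo : ∀ q, PeelsTo (μ T.init) (μ q)

theorem PeelsTo.isLeast {z u : List A} (hz : IsLeast z) (h : PeelsTo z u) : IsLeast u := by
  induction h with
  | refl => exact hz
  | step _ h ih => exact ih.peel h

/-- If `q` realizes `f_w`, then its successor on `β` realizes `f_{w ∘ β}`. -/
theorem exists_next_of_accFun_eq {T : Transducer Q (Fin 2) A} {q : Q} {w u : List A} {β : Fin 2}
    {a : A} (h : T.accFun q = wordFun w) (hu : IsPeel w β a u) :
    ∃ p, T.next q β = some p ∧ T.out q β = some a ∧ T.accFun p = wordFun u := by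
  obtain ⟨γ, r, hr⟩ := exists_wordFun_eq_some u
  have h1 : T.accFun q (β :: γ) = some (a :: r) := by
    rw [h, hu.wordFun_cons, hr, Option.map_some]
  cases hp : T.next q β with
  | none => rw [accFun_cons_of_eq_none hp] at h1; exact absurd h1 (by simp)
  | some p =>
    obtain ⟨b, hb⟩ := Option.isSome_iff_exists.1 ((T.next_isSome_iff q β).1 (by simp [hp]))
    obtain rfl : b = a := by
      rw [accFun_cons hp hb] at h1
      obtain ⟨s, -, hs⟩ := Option.map_eq_some_iff.1 h1
      exact (List.cons.inj hs).1
    refine ⟨p, rfl, hb, funext fun δ => Option.map_injective (List.cons_injective (a := b)) ?_⟩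
    rw [← accFun_cons hp hb, h, hu.wordFun_cons]

/-- The words `z ∘ α`, where `z = min(x)`, have pairwise distinct functions, each of which is
realized by some state of `T`; since they are the states of a transducer that realizes `f_z`,
minimality of `T` makes this correspondence a bijection. -/
theorem IsMinimalRepresenting.exists_isLabelling {T : Transducer Q (Fin 2) A} {x : FreeBand A}
    (hT : T.IsMinimalRepresenting x) :
    Finite Q ∧ ∃ μ, T.IsLabelling μ ∧ IsMinWord x (μ T.init) := by
  obtain ⟨w, hw, hreal, hmin⟩ := hT
  obtain ⟨z, hz⟩ := exists_isMinWord x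
  have hzl : IsLeast z := by
    rw [IsLeast, hz.1]
    exact hz
  have hwz : wordFun w = wordFun z := wordFun_eq_of_ofWord_eq (hw.trans hz.1.symm)
  have hinit : T.accFun T.init = wordFun z := by rw [← hwz, ← realizes_iff.1 hreal]
  have hle := hmin _ (canonical z) (realizes_iff.2 (by
    rw [hwz, accFun_canonical]
    rfl))
  have : Finite {u // PeelsTo z u} := finite_peelsTo z
  have hQ : Finite Q :=
    Cardinal.lt_aleph0_iff_finite.1 (hle.trans_lt (Cardinal.lt_aleph0_of_finite _))
  have hex : ∀ u : {u // PeelsTo z u}, ∃ q, T.accFun q = wordFun u.1 := by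
    rintro ⟨u, hu⟩
    induction hu with
    | refl => exact ⟨_, hinit⟩
    | step _ h ih =>
      obtain ⟨q, hq⟩ := ih
      obtain ⟨p, -, -, hp⟩ := exists_next_of_accFun_eq hq h
      exact ⟨p, hp⟩
  choose f hf using hex
  have hinj : ∀ u v, PeelsTo z u → PeelsTo z v → wordFun u = wordFun v → u = v :=
    fun u v hu hv h => (hu.isLeast hzl).eq_of_ofWord_eq (hv.isLeast hzl)
      (ofWord_eq_of_wordFun_eq h)
  have hfi : Function.Injective f := fun u v h =>
    Subtype.ext (hinj _ _ u.2 v.2 (by rw [← hf, ← hf, h]))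
  have hfb : Function.Bijective f := by
    refine (Nat.bijective_iff_injective_and_card f).2 ⟨hfi, ?_⟩
    refine le_antisymm (Nat.card_le_card_of_injective f hfi) ?_
    exact Cardinal.toNat_le_toNat hle (Cardinal.lt_aleph0_of_finite _)
  let e := Equiv.ofBijective f hfb
  have he : ∀ q, T.accFun q = wordFun (e.symm q).1 := fun q => by
    rw [← hf]
    exact congrArg _ (e.apply_symm_apply q).symm
  have hμ : ∀ q u, PeelsTo z u → T.accFun q = wordFun u → (e.symm q).1 = u := fun q u hu h =>
    hinj _ _ (e.symm q).2 hu (by rw [← he, h])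
  have hi : (e.symm T.init).1 = z := hμ _ _ .refl hinit
  refine ⟨hQ, fun q => (e.symm q).1, ⟨fun q => (e.symm q).2.isLeast hzl,
    Subtype.val_injective.comp e.symm.injective, fun q => ?_, fun q β hq => ?_, fun q β hq => ?_,
    fun q => ?_⟩, ?_⟩
  · rw [← accFun_nil_eq_some, he]
    by_cases h : (e.symm q).1 = []
    · simp [h, wordFun]
    · simp [h, wordFun_nil h]
  · obtain ⟨a, u, hu⟩ := exists_isPeel hq β
    obtain ⟨p, hp, ha, h⟩ := exists_next_of_accFun_eq (he q) hu
    refine ⟨a, p, hp, ha, ?_⟩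
    rw [hμ p u ((e.symm q).2.step hu) h]
    exact hu
  · cases hp : T.next q β with
    | none => rfl
    | some p =>
      obtain ⟨b, hb⟩ := Option.isSome_iff_exists.1 ((T.next_isSome_iff q β).1 (by simp [hp]))
      obtain ⟨γ, r, hr⟩ := exists_wordFun_eq_some (e.symm p).1
      have := accFun_cons hp hb γ
      rw [he, he, hq, hr, wordFun_nil_cons] at this
      exact absurd this (by simp)
  · rw [hi]
    exact (e.symm q).2
  · change IsMinWord x (e.symm T.init).1
    rw [hi]
    exact hz

/-- A maximal prefix with a given number of letters is determined by that number. -/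
theorem eq_of_append_cons_eq {u v s s' : List A} {a b : A} (h : u ++ a :: s = v ++ b :: s')
    (ha : a ∉ u) (hb : b ∉ v) (huv : contCard u = contCard v) : u = v := by
  rcases List.append_eq_append_iff.1 h with ⟨x, hx, hy⟩ | ⟨x, hx, hy⟩
  · cases x with
    | nil => simp [hx]
    | cons c x =>
      obtain ⟨rfl, -⟩ := List.cons.inj hy
      exact absurd huv (contCard_lt (by simp [hx]) (by simp [hx]) ha).ne
  · cases x with
    | nil => simp [hx]
    | cons c x =>
      obtain ⟨rfl, -⟩ := List.cons.inj hy
      exact absurd huv (contCard_lt (by simp [hx]) (by simp [hx]) hb).ne'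

theorem eq_of_append_cons_eq_right {u v s s' : List A} {a b : A} (h : s ++ a :: u = s' ++ b :: v)
    (ha : a ∉ u) (hb : b ∉ v) (huv : contCard u = contCard v) : u = v := by
  have hr : ∀ w : List A, contCard w.reverse = contCard w := fun w => by simp [contCard]
  rw [← List.reverse_inj]
  refine eq_of_append_cons_eq (a := a) (b := b) (s := s.reverse) (s' := s'.reverse) ?_
    (by simpa using ha) (by simpa using hb) (by rw [hr, hr, huv])
  simpa using congrArg List.reverse h

/-- Every state `q ≠ q₀` is determined by the operation `β` in the last step of a path from `q₀` to
`q`, by the number of letters of `μ q`, and by the position of an end of `μ q` in `μ q₀`: the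
factor `μ q` is maximal among the factors with this many letters that begin there (for `β = 0`) or
end there (for `β = 1`). -/
theorem IsLabelling.card_le [Finite Q] {T : Transducer Q (Fin 2) A} {μ : Q → List A}
    (h : T.IsLabelling μ) :
    Nat.card Q ≤ 1 + 2 * ((μ T.init).length + 1) * contCard (μ T.init) := by
  classical
  have hcard : ∀ u, PeelsTo (μ T.init) u → contCard u ≤ contCard (μ T.init) := fun u hu => by
    obtain ⟨r, s, hz⟩ := hu.exists_append
    exact contCard_mono fun c hc => by simp [hz, hc]
  let P : Fin 2 → ℕ → List A → Prop := fun β i u => ∃ r s a, a ∉ u ∧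
    match β with
    | 0 => μ T.init = r ++ u ++ a :: s ∧ i = r.length
    | 1 => μ T.init = s ++ a :: u ++ r ∧ i = r.length
  have hP : ∀ β i u v, P β i u → P β i v → contCard u = contCard v → u = v := by
    rintro β i u v ⟨r, s, a, ha, h⟩ ⟨r', s', b, hb, h'⟩ huv
    match β, h, h' with
    | 0, ⟨h, hi⟩, ⟨h', hi'⟩ =>
      rw [h, List.append_assoc, List.append_assoc] at h'
      exact eq_of_append_cons_eq (List.append_inj h' (hi.symm.trans hi')).2 ha hb huv
    | 1, ⟨h, hi⟩, ⟨h', hi'⟩ =>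
      rw [h] at h'
      exact eq_of_append_cons_eq_right (List.append_inj' h' (hi.symm.trans hi')).1 ha hb huv
  have hex : ∀ q, q ≠ T.init → ∃ β i, i < (μ T.init).length + 1 ∧
      contCard (μ q) < contCard (μ T.init) ∧ P β i (μ q) := by
    intro q hq
    rcases (h.peelsTo q).eq_or with hh | ⟨w, β, a, hw, hu⟩
    · exact absurd (h.injective hh) hq
    · have hlt : contCard (μ q) < contCard (μ T.init) := by
        have := hu.contCard
        have := hcard w hw
        omega
      obtain ⟨r, s, hz⟩ := hw.exists_append
      have ha := hu.notMem
      match β, hu with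
      | 0, ⟨g, hg, _, _⟩ =>
        refine ⟨0, r.length, ?_, hlt, r, g ++ s, a, ha, by simp [hz, hg], rfl⟩
        simp only [hz, List.length_append]
        omega
      | 1, ⟨g, hg, _, _⟩ =>
        refine ⟨1, s.length, ?_, hlt, s, r ++ g, a, ha, by simp [hz, hg], rfl⟩
        simp only [hz, List.length_append]
        omega
  choose β i hi hc hp using hex
  let f : Q → Option (Fin 2 × Fin ((μ T.init).length + 1) × Fin (contCard (μ T.init))) := fun q =>
    if hq : q = T.init then none else some (β q hq, ⟨i q hq, hi q hq⟩, ⟨_, hc q hq⟩)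
  have hf : Function.Injective f := by
    intro p q hpq
    by_cases hp' : p = T.init <;> by_cases hq' : q = T.init
    · rw [hp', hq']
    · simp [f, hp', hq'] at hpq
    · simp [f, hp', hq'] at hpq
    · simp only [f, hp', hq', dite_false, Option.some.injEq, Prod.mk.injEq, Fin.mk.injEq] at hpq
      obtain ⟨h1, h2, h3⟩ := hpq
      have h4 := hp p hp'
      rw [h1, h2] at h4
      exact h.injective (hP _ _ _ _ h4 (hp q hq') h3)
  have := Nat.card_le_card_of_injective f hf
  simp only [Finite.card_option, Nat.card_prod, Nat.card_fin] at this
  linarith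

/-- The path `00⋯0` from `q` passes through words with every smaller number of letters. -/
theorem IsLabelling.exists_contCard_eq {T : Transducer Q (Fin 2) A} {μ : Q → List A}
    (h : T.IsLabelling μ) (n k : ℕ) (q : Q) (hq : contCard (μ q) = k + n) :
    ∃ p, contCard (μ p) = k := by
  induction n generalizing q with
  | zero => exact ⟨q, hq⟩
  | succ n ih =>
    obtain ⟨a, p, -, -, hp⟩ := h.step q 0 fun h0 => by
      rw [contCard_eq_zero.2 h0] at hq
      omega
    refine ih p ?_
    have := hp.contCard
    omega

theorem IsLabelling.contCard_lt_card [Finite Q] {T : Transducer Q (Fin 2) A} {μ : Q → List A}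
    (h : T.IsLabelling μ) (q : Q) : contCard (μ q) < Nat.card Q := by
  have : ∀ k : Fin (contCard (μ q) + 1), ∃ p, contCard (μ p) = k := fun k =>
    h.exists_contCard_eq (contCard (μ q) - k) k q (by omega)
  choose f hf using this
  have := Nat.card_le_card_of_injective f fun i j hij => Fin.ext (by rw [← hf, ← hf, hij])
  simpa using this

end Labelling

end Transducer

/-! ### Runs of programs -/

namespace RAM

section Runs

variable {A Q α β : Type}

/-- The contents of the memory without the clock and the space counter. -/
structure State (A Q : Type) where
  /-- the word `w` -/
  word : List A
  /-- the partial function `B` -/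
  table : Q → Option (ℕ × ℕ)
  /-- the number of activation records on the stack -/
  frames : ℕ

/-- Started with memory contents `s`, the program `p` halts with result `r` and contents `s'` after
at most `t` units of time, and occupies at most `X` memory cells meanwhile. -/
def Runs (X : ℕ) (p : RAM A Q α) (s : State A Q) (t : ℕ) (r : α) (s' : State A Q) : Prop :=
  ∀ m : Mem A Q, m.word = s.word → m.table = s.table → m.frames = s.frames →
    ∃ m' : Mem A Q, p m = some (r, m') ∧ m'.word = s'.word ∧ m'.table = s'.table ∧
      m'.frames = s'.frames ∧ m'.time ≤ m.time + t ∧ m'.peak ≤ max m.peak X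

/-- The memory contents `s` occupy at most `X` cells. -/
def Fits (X : ℕ) (s : State A Q) : Prop := cells Q s.word s.frames ≤ X

theorem Fits.mono {X : ℕ} {s s' : State A Q} (h : Fits X s')
    (hw : s.word.length ≤ s'.word.length) (hf : s.frames ≤ s'.frames) : Fits X s := by
  unfold Fits cells at *
  omega

variable {X : ℕ} {s s' s'' : State A Q}

theorem Runs.bind {p : RAM A Q α} {k : α → RAM A Q β} {t t' : ℕ} {r : α} {r' : β}
    (h : Runs X p s t r s') (h' : Runs X (k r) s' t' r' s'') :
    Runs X (p >>= k) s (t + t') r' s'' := by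
  intro m h1 h2 h3
  obtain ⟨m', e, h1, h2, h3, ht, hp⟩ := h m h1 h2 h3
  obtain ⟨m'', e', h1, h2, h3, ht', hp'⟩ := h' m' h1 h2 h3
  refine ⟨m'', ?_, h1, h2, h3, by omega, hp'.trans (max_le hp (le_max_right _ _))⟩
  change (p m).bind (fun x => k x.1 x.2) = _
  rw [e]
  exact e'

theorem runs_pure (r : α) : Runs X (pure r) s 0 r s :=
  fun m h1 h2 h3 => ⟨m, rfl, h1, h2, h3, by omega, le_max_left _ _⟩

theorem Runs.mono {p : RAM A Q α} {t t' : ℕ} {r : α} (h : Runs X p s t r s') (ht : t ≤ t') :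
    Runs X p s t' r s' := by
  intro m h1 h2 h3
  obtain ⟨m', e, h1, h2, h3, h4, h5⟩ := h m h1 h2 h3
  exact ⟨m', e, h1, h2, h3, by omega, h5⟩

theorem runs_elementary {f : Mem A Q → Option (α × List A × (Q → Option (ℕ × ℕ)) × ℕ)} {r : α}
    (hX : Fits X s')
    (h : ∀ m : Mem A Q, m.word = s.word → m.table = s.table → m.frames = s.frames →
      f m = some (r, s'.word, s'.table, s'.frames)) :
    Runs X (elementary f) s 1 r s' := by
  intro m h1 h2 h3
  refine ⟨⟨s'.word, s'.table, s'.frames, m.time + 1, max m.peak (cells Q s'.word s'.frames)⟩,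
    ?_, rfl, rfl, rfl, le_rfl, max_le_max le_rfl hX⟩
  rw [elementary, h m h1 h2 h3]

theorem runs_compute (hX : Fits X s) (r : α) : Runs X (compute r) s 1 r s :=
  runs_elementary hX fun m h1 h2 h3 => by rw [h1, h2, h3]

theorem runs_pushFrame (hX : Fits X ⟨s.word, s.table, s.frames + 1⟩) :
    Runs X pushFrame s 1 () ⟨s.word, s.table, s.frames + 1⟩ :=
  runs_elementary hX fun m h1 h2 h3 => by rw [h1, h2, h3]

theorem runs_popFrame (hX : Fits X s) :
    Runs X popFrame s 1 () ⟨s.word, s.table, s.frames - 1⟩ :=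
  runs_elementary (hX.mono le_rfl (Nat.sub_le _ _)) fun m h1 h2 h3 => by rw [h1, h2, h3]

theorem runs_next {T : Transducer Q (Fin 2) A} {q p : Q} {a : Fin 2} (hX : Fits X s)
    (h : T.next q a = some p) : Runs X (next T q a) s 1 p s :=
  runs_elementary hX fun m h1 h2 h3 => by rw [h, h1, h2, h3]; rfl

theorem runs_out {T : Transducer Q (Fin 2) A} {q : Q} {a : Fin 2} {b : A} (hX : Fits X s)
    (h : T.out q a = some b) : Runs X (out T q a) s 1 b s :=
  runs_elementary hX fun m h1 h2 h3 => by rw [h, h1, h2, h3]; rfl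

theorem runs_isTerminal {T : Transducer Q (Fin 2) A} [DecidablePred (· ∈ T.terminal)]
    (hX : Fits X s) (q : Q) : Runs X (isTerminal T q) s 1 (decide (q ∈ T.terminal)) s :=
  runs_elementary hX fun m h1 h2 h3 => by rw [h1, h2, h3]

theorem runs_lookup (hX : Fits X s) (q : Q) : Runs X (lookup q) s 1 (s.table q) s :=
  runs_elementary hX fun m h1 h2 h3 => by rw [h1, h2, h3]

theorem runs_assign [DecidableEq Q] (hX : Fits X s) (q : Q) (ij : ℕ × ℕ) :
    Runs X (assign q ij) s 1 () ⟨s.word, Function.update s.table q (some ij), s.frames⟩ :=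
  runs_elementary hX fun m h1 h2 h3 => by rw [h1, h2, h3]

theorem runs_wordLength (hX : Fits X s) : Runs X wordLength s 1 s.word.length s :=
  runs_elementary hX fun m h1 h2 h3 => by rw [h1, h2, h3]

theorem runs_readLetter (hX : Fits X s) {u v : List A} {c : A} (hw : s.word = u ++ c :: v) :
    Runs X (readLetter (u.length + 1)) s 1 c s :=
  runs_elementary hX fun m h1 h2 h3 => by
    rw [h1, h2, h3]
    simp [hw]

theorem runs_appendLetter {c : A} (hX : Fits X ⟨s.word ++ [c], s.table, s.frames⟩) :
    Runs X (appendLetter c) s 1 () ⟨s.word ++ [c], s.table, s.frames⟩ :=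
  runs_elementary hX fun m h1 h2 h3 => by rw [h1, h2, h3]

theorem runs_copyLetters {r u v w : List A} {B : Q → Option (ℕ × ℕ)} {d : ℕ}
    (hX : Fits X ⟨w ++ u, B, d⟩) (hw : w = r ++ u ++ v) :
    Runs X (copyLetters (r.length + 1) u.length) ⟨w, B, d⟩ (4 * u.length + 1) ()
      ⟨w ++ u, B, d⟩ := by
  induction u generalizing r v w with
  | nil =>
    rw [List.append_nil] at hX ⊢
    exact runs_compute hX ()
  | cons c u ih =>
    have hX' : Fits X ⟨w ++ [c], B, d⟩ := hX.mono (by simp) le_rfl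
    have hX0 : Fits X ⟨w, B, d⟩ := hX.mono (by simp) le_rfl
    have := ih (r := r ++ [c]) (v := v ++ [c]) (w := w ++ [c]) (by simpa using hX) (by simp [hw])
    simp only [List.length_append, List.length_singleton, List.append_assoc,
      List.singleton_append] at this
    refine ((runs_compute hX0 ()).bind ((runs_readLetter (v := u ++ v) hX0 (by simp [hw])).bind
      ((runs_appendLetter hX').bind ((runs_compute hX' _).bind this)))).mono ?_
    simp only [List.length_cons]
    omega

theorem runs_subwordLength (hX : Fits X s) (i j : ℕ) :
    Runs X (subwordLength i j) s 4 (if 0 < i ∧ i ≤ j then j - i + 1 else 0) s := by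
  refine (Runs.bind (runs_compute hX _) (Runs.bind (runs_compute hX _) (t' := 2) ?_)).mono
    (by omega)
  by_cases h : 0 < i ∧ i ≤ j
  · rw [if_pos h, if_pos (by simp [h])]
    exact (runs_compute hX _).bind (runs_compute hX _)
  · rw [if_neg h, if_neg (by simpa using h)]
    exact (runs_compute hX _).mono (by omega)

theorem runs_nextIterate {T : Transducer Q (Fin 2) A} {q p : Q} {a : Fin 2} {k : ℕ}
    (hX : Fits X s) (h : T.nextWord q (List.replicate k a) = some p) :
    Runs X (nextIterate T q a k) s (2 * k + 1) p s := by
  induction k generalizing q with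
  | zero =>
    obtain rfl : q = p := by simpa [Transducer.nextWord] using h
    exact runs_compute hX _
  | succ k ih =>
    rw [List.replicate_succ, Transducer.nextWord] at h
    obtain ⟨q', hq, h⟩ := Option.bind_eq_some_iff.1 h
    exact ((runs_compute hX _).bind ((runs_next hX hq).bind (ih h))).mono (by omega)

/-! ### Monotonicity in the fuel -/

/-- The program `p'` halts whenever `p` does, and with the same outcome. -/
def Extends (p p' : RAM A Q α) : Prop := ∀ m r, p m = some r → p' m = some r

theorem extends_refl (p : RAM A Q α) : Extends p p := fun _ _ h => h

theorem Extends.bind {p p' : RAM A Q α} {k k' : α → RAM A Q β} (h : Extends p p')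
    (hk : ∀ a, Extends (k a) (k' a)) : Extends (p >>= k) (p' >>= k') := by
  intro m r hr
  change (p m).bind (fun x => k x.1 x.2) = _ at hr
  change (p' m).bind (fun x => k' x.1 x.2) = _
  obtain ⟨x, hx, h'⟩ := Option.bind_eq_some_iff.1 hr
  rw [h m x hx]
  exact hk _ _ _ h'

theorem failure_extends (p : RAM A Q α) : Extends failure p := by
  intro m r hr
  change (none : Option (α × Mem A Q)) = _ at hr
  exact absurd hr (by simp)

variable {T : Transducer Q (Fin 2) A} [DecidablePred (· ∈ T.terminal)]

theorem contentSize_extends (fuel : ℕ) (q : Q) (n : ℕ) :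
    Extends (contentSize T fuel q n) (contentSize T (fuel + 1) q n) := by
  induction fuel generalizing q n with
  | zero => exact failure_extends _
  | succ fuel ih =>
    rw [contentSize, contentSize.eq_def T (fuel + 1 + 1)]
    refine (extends_refl _).bind fun t => ?_
    cases t
    · exact (extends_refl _).bind fun p => (extends_refl _).bind fun n' => ih _ _
    · exact extends_refl _

theorem minWord_extends [DecidableEq A] [DecidableEq Q] (fuel : ℕ) (q : Q) (l : ℕ) :
    Extends (minWord T fuel q l) (minWord T (fuel + 1) q l) := by
  induction fuel generalizing q l with
  | zero => exact failure_extends _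
  | succ fuel ih =>
    rw [minWord, minWord.eq_def T (fuel + 1 + 1)]
    refine (extends_refl _).bind fun _ => (extends_refl _).bind fun _ =>
      (extends_refl _).bind fun _ => (extends_refl _).bind fun _ =>
      (extends_refl _).bind fun b => ?_
    cases b with
    | some ij => exact extends_refl _
    | none =>
      refine (extends_refl _).bind fun _ => (ih _ _).bind fun _ => ?_
      refine Extends.bind ?_ fun _ => (extends_refl _).bind fun _ => (extends_refl _).bind fun _ =>
        (ih _ _).bind fun _ => extends_refl _
      exact (contentSize_extends _ _ _).bind fun _ => extends_refl _

end Runs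

end RAM

/-! ### Paths in a labelled transducer -/

namespace Transducer

section Paths

variable {A Q : Type} {T : Transducer Q (Fin 2) A}

theorem nextWord_append (q : Q) (α γ : List (Fin 2)) :
    T.nextWord q (α ++ γ) = (T.nextWord q α).bind fun p => T.nextWord p γ := by
  induction α generalizing q with
  | nil => rfl
  | cons β α ih =>
    rw [List.cons_append, nextWord, nextWord]
    cases T.next q β with
    | none => rfl
    | some p => exact ih p

theorem nextWord_replicate_succ {q p r : Q} {k : ℕ} {β : Fin 2}
    (h : T.nextWord q (List.replicate k β) = some p) (hp : T.next p β = some r) :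
    T.nextWord q (List.replicate (k + 1) β) = some r := by
  rw [List.replicate_succ', nextWord_append, h, Option.bind_some, nextWord, hp]
  rfl

variable [LinearOrder A] {μ : Q → List A}

theorem IsLabelling.isPeel (h : T.IsLabelling μ) {q p : Q} {β : Fin 2} (hp : T.next q β = some p) :
    ∃ a, T.out q β = some a ∧ IsPeel (μ q) β a (μ p) := by
  by_cases hq : μ q = []
  · rw [h.next_eq_none q β hq] at hp
    exact absurd hp (by simp)
  · obtain ⟨a, p', hp', ha, hu⟩ := h.step q β hq
    obtain rfl : p' = p := Option.some_injective _ (hp'.symm.trans hp)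
    exact ⟨a, ha, hu⟩

theorem IsLabelling.exists_eq_append (h : T.IsLabelling μ) {q p : Q} {k : ℕ}
    (hp : T.nextWord q (List.replicate k 0) = some p) : ∃ g, μ q = μ p ++ g := by
  induction k generalizing q with
  | zero =>
    obtain rfl : q = p := by simpa [nextWord] using hp
    exact ⟨[], by simp⟩
  | succ k ih =>
    rw [List.replicate_succ, nextWord] at hp
    obtain ⟨q', hq, hp⟩ := Option.bind_eq_some_iff.1 hp
    obtain ⟨g, hg⟩ := ih hp
    obtain ⟨a, -, g', hg', -, -⟩ := h.isPeel hq
    exact ⟨g ++ a :: g', by rw [hg', hg, List.append_assoc]⟩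

theorem IsLabelling.exists_nil (h : T.IsLabelling μ) (q : Q) :
    ∃ k p, T.nextWord q (List.replicate k 0) = some p ∧ μ p = [] := by
  by_cases hq : μ q = []
  · exact ⟨0, q, rfl, hq⟩
  · obtain ⟨a, p, hp, -, hu⟩ := h.step q 0 hq
    have := hu.length_lt
    obtain ⟨k, r, hr, hr'⟩ := h.exists_nil p
    refine ⟨k + 1, r, ?_, hr'⟩
    rw [List.replicate_succ, nextWord, hp]
    exact hr
termination_by (μ q).length

end Paths

end Transducer

/-! ### Classification of the overlaps -/

namespace RAM

section Classify

variable {A : Type} [LinearOrder A] {Q : Type} {T : Transducer Q (Fin 2) A}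
  [DecidablePred (· ∈ T.terminal)] {μ : Q → List A} {X : ℕ} {s : State A Q}

theorem runs_contentSize (h : T.IsLabelling μ) (hX : Fits X s) {fuel : ℕ} {q : Q} (n : ℕ)
    (hf : contCard (μ q) < fuel) :
    Runs X (contentSize T fuel q n) s (3 * contCard (μ q) + 1) (n + contCard (μ q)) s := by
  induction fuel generalizing q n with
  | zero => omega
  | succ fuel ih =>
    rw [contentSize]
    by_cases hq : μ q = []
    · refine ((runs_isTerminal hX q).bind (t' := 0) ?_).mono (by omega)
      rw [if_pos (by simpa using (h.terminal q).2 hq), contCard_eq_zero.2 hq]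
      exact runs_pure n
    · obtain ⟨a, p, hp, -, hu⟩ := h.step q 0 hq
      have hc := hu.contCard
      refine ((runs_isTerminal hX q).bind (t' := 3 * contCard (μ q)) ?_).mono (by omega)
      rw [if_neg (by simpa using fun h' => hq ((h.terminal q).1 h')), hc]
      have := ih (q := p) (n + 1) (by omega)
      rw [add_assoc, add_comm 1] at this
      exact ((runs_next hX hp).bind ((runs_compute hX _).bind this)).mono (by omega)

/-- What the result `(o, k)` of `classifyCase` says about `min(y) = μ q`, where `p = q ♠ 0` and
`p' = q ♠ 1`, `a = q ♣ 0` and `b = q ♣ 1`: how `min(y)` is composed of its prefix `μ p` and its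
suffix `μ p'`. In the second case, `μ r` is the part of `μ p` and `μ p'` that is shared. -/
def Composed (T : Transducer Q (Fin 2) A) (μ : Q → List A) (q p p' : Q) (a b : A) (k : ℕ) :
    OverlapCase → Prop
  | .i => μ q = μ p ++ a :: μ p'
  | .ii => k ≤ contCard (μ q) ∧ ∃ r u v, T.nextWord p (List.replicate k 1) = some r ∧
      T.nextWord p' (List.replicate k 0) = some r ∧ μ p = u ++ μ r ∧ μ p' = μ r ++ v ∧
      μ q = μ p ++ v
  | .iii => μ q = μ p ++ a :: b :: μ p'

variable [DecidableEq Q]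

/-- The loop searches for `k` such that `μ (q ♠ 01ᵏ) = μ (q ♠ 10ᵏ)`. As long as `k` has not been
found, an overlap of the prefix `(μ p) a` with the suffix `b (μ p')` of `μ q` is also one of the
word `(μ u) a`, where `μ u` is a suffix of `μ p`, with `b (μ v)`, where `μ v` is a prefix of
`μ p'`. When such a word `μ u` becomes empty, there is no overlap. -/
theorem runs_classifyLoop (h : T.IsLabelling μ) (hX : Fits X s) {q p p' : Q} {a b : A} {c : ℕ}
    (hp : IsPeel (μ q) 0 a (μ p)) (hp' : IsPeel (μ q) 1 b (μ p')) (hab : a ≠ b)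
    (ha : T.out q 0 = some a) (hb : T.out q 1 = some b) (r k : ℕ) (u v : Q)
    (hu : T.nextWord p (List.replicate k 1) = some u)
    (hv : T.nextWord p' (List.replicate k 0) = some v) (hu0 : μ u ≠ [])
    (huv : contCard (μ u) = contCard (μ v)) (hr : contCard (μ u) ≤ r)
    (hk : k + contCard (μ u) < contCard (μ q))
    (hup : ∃ x, μ p = x ++ μ u) (hvp : ∃ x, μ p' = μ v ++ x)
    (hov : ∀ x t y, μ p = x ++ b :: t → μ p' = t ++ a :: y →
      (∃ x', μ u = x' ++ b :: t) ∧ ∃ y', μ v = t ++ a :: y') :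
    ∃ o k', Runs X (classifyLoop T q c r (k + 1) u v) s (13 * r) (o, k') s ∧
      Composed T μ q p p' a b k' o := by
  induction r generalizing k u v with
  | zero => exact absurd (contCard_eq_zero.1 (by omega)) hu0
  | succ r ih =>
    have hv0 : μ v ≠ [] := by
      rw [Ne, ← contCard_eq_zero, ← huv, contCard_eq_zero]
      exact hu0
    obtain ⟨b', u', hu', hbu, hPu⟩ := h.step u 1 hu0
    obtain ⟨a', v', hv', hav, hPv⟩ := h.step v 0 hv0
    have hcu := hPu.contCard
    have hcv := hPv.contCard
    have hu1 := Transducer.nextWord_replicate_succ hu hu'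
    have hv1 := Transducer.nextWord_replicate_succ hv hv'
    have hbu' := hPu.notMem
    have hav' := hPv.notMem
    have hup' : ∃ x, μ p = x ++ b' :: μ u' := by
      obtain ⟨x, hx⟩ := hup
      obtain ⟨g, hg, -, -⟩ := hPu
      exact ⟨x ++ g, by rw [hx, hg, List.append_assoc]⟩
    have hvp' : ∃ x, μ p' = μ v' ++ a' :: x := by
      obtain ⟨x, hx⟩ := hvp
      obtain ⟨g, hg, -, -⟩ := hPv
      exact ⟨g ++ x, by simp [hx, hg]⟩
    -- the iteration in which `k` is found
    by_cases hm : b' = b ∧ a' = a ∧ u' = v'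
    · obtain ⟨rfl, rfl, rfl⟩ := hm
      obtain ⟨x, hx⟩ := hup'
      obtain ⟨y, hy⟩ := hvp'
      refine ⟨.ii, k + 1, ?_, by omega, u', x ++ [b'], a' :: y, hu1, hv1, by simp [hx], hy,
        (h.least q).eq_of_overlap hp hp' hab hx hy⟩
      rw [classifyLoop]
      refine (Runs.bind (runs_compute hX ()) <| (runs_out hX hbu).bind <| (runs_out hX hb).bind <|
        (runs_compute hX _).bind <| (runs_out hX hav).bind <| (runs_out hX ha).bind <|
        (runs_compute hX _).bind <| (runs_next hX hu').bind <| (runs_next hX hv').bind <|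
        (runs_compute hX _).bind (t' := 0) ?_).mono (by omega)
      rw [if_pos (by simp)]
      exact runs_pure _
    -- otherwise every overlap is still contained in the remaining words
    have hov' : ∀ x t y, μ p = x ++ b :: t → μ p' = t ++ a :: y →
        (∃ x', μ u' = x' ++ b :: t) ∧ ∃ y', μ v' = t ++ a :: y' := by
      intro x t y hx hy
      obtain ⟨⟨x', hx'⟩, ⟨y', hy'⟩⟩ := hov x t y hx hy
      have hbt : b ∉ t := fun hbt => hp'.notMem (by simp [hy, hbt])
      have hat : a ∉ t := fun hat => hp.notMem (by simp [hx, hat])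
      obtain ⟨g, hg, -, hgs⟩ := hPu
      obtain ⟨g', hg', -, hgs'⟩ := hPv
      have hL : (b' = b ∧ μ u' = t) ∨ ∃ x', μ u' = x' ++ b :: t := by
        rcases List.append_eq_append_iff.1 (hg.symm.trans hx') with ⟨e, he, he'⟩ | ⟨e, he, he'⟩
        · cases e with
          | nil => exact .inl (List.cons.inj he')
          | cons d e => exact .inr ⟨e, (List.cons.inj he').2⟩
        · cases e with
          | nil => exact .inl ⟨(List.cons.inj he').1.symm, (List.cons.inj he').2.symm⟩
          | cons d e =>
            obtain ⟨rfl, rfl⟩ := List.cons.inj he'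
            have := hgs (show b ∈ g by simp [he])
            exact absurd (List.mem_append_right e this) hbt
      have hR : (a' = a ∧ μ v' = t) ∨ ∃ y', μ v' = t ++ a :: y' := by
        rcases List.append_eq_append_iff.1 (hg'.symm.trans hy') with ⟨e, he, he'⟩ | ⟨e, he, he'⟩
        · cases e with
          | nil => exact .inl ⟨(List.cons.inj he').1, by simp [he]⟩
          | cons d e =>
            obtain ⟨rfl, rfl⟩ := List.cons.inj he'
            have := hgs' (show a ∈ e ++ a :: y' by simp)
            refine absurd ?_ hat
            simp only [he, List.mem_append, List.mem_cons] at this ⊢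
            tauto
        · cases e with
          | nil => exact .inl ⟨(List.cons.inj he').1.symm, by simp [he]⟩
          | cons d e =>
            obtain ⟨rfl, -⟩ := List.cons.inj he'
            exact .inr ⟨e, he⟩
      rcases hL with ⟨rfl, hL⟩ | ⟨x₁, hL⟩ <;> rcases hR with ⟨rfl, hR⟩ | ⟨y₁, hR⟩
      · exact absurd ⟨rfl, rfl, h.injective (hL.trans hR.symm)⟩ hm
      · have := contCard_lt (u := t) (v := μ v') (c := a) (by simp [hR]) (by simp [hR]) hat
        rw [← hL] at this
        omega
      · have := contCard_lt (u := t) (v := μ u') (c := b) (by simp [hL]) (by simp [hL]) hbt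
        rw [← hR] at this
        omega
      · exact ⟨⟨x₁, hL⟩, ⟨y₁, hR⟩⟩
    have hdec : (decide (b' = b) && decide (a' = a) && decide (u' = v')) = false := by
      simp only [Bool.and_eq_false_iff, decide_eq_false_iff_not]
      tauto
    by_cases ht : μ u' = []
    · refine ⟨.iii, c, ?_, ?_⟩
      · rw [classifyLoop]
        refine (Runs.bind (runs_compute hX ()) <| (runs_out hX hbu).bind <| (runs_out hX hb).bind <|
          (runs_compute hX _).bind <| (runs_out hX hav).bind <| (runs_out hX ha).bind <|
          (runs_compute hX _).bind <| (runs_next hX hu').bind <| (runs_next hX hv').bind <|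
          (runs_compute hX _).bind (t' := 3) ?_).mono (by omega)
        rw [if_neg (by simp [hdec])]
        refine ((runs_isTerminal hX u').bind <| (runs_isTerminal hX v').bind (t' := 0) ?_).mono
          (by omega)
        rw [if_pos (by simp [(h.terminal u').2 ht])]
        exact runs_pure _
      · refine (h.least q).eq_of_not_overlap hp hp' hab fun x t y hx hy => ?_
        obtain ⟨⟨x', hx'⟩, -⟩ := hov' x t y hx hy
        simp [ht] at hx'
    · obtain ⟨o, k', hrun, ho⟩ := ih (k + 1) u' v' hu1 hv1 ht (by omega) (by omega) (by omega)
        (by obtain ⟨x, hx⟩ := hup'; exact ⟨x ++ [b'], by simp [hx]⟩)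
        (by obtain ⟨x, hx⟩ := hvp'; exact ⟨a' :: x, hx⟩) hov'
      refine ⟨o, k', ?_, ho⟩
      have ht' : μ v' ≠ [] := fun h0 => ht (contCard_eq_zero.1 (by
        have := contCard_eq_zero.2 h0
        omega))
      rw [classifyLoop]
      refine (Runs.bind (runs_compute hX ()) <| (runs_out hX hbu).bind <| (runs_out hX hb).bind <|
        (runs_compute hX _).bind <| (runs_out hX hav).bind <| (runs_out hX ha).bind <|
        (runs_compute hX _).bind <| (runs_next hX hu').bind <| (runs_next hX hv').bind <|
        (runs_compute hX _).bind (t' := 3 + 13 * r) ?_).mono (by omega)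
      rw [if_neg (by simp [hdec])]
      refine ((runs_isTerminal hX u').bind <| (runs_isTerminal hX v').bind (t' := 1 + 13 * r)
        ?_).mono (by omega)
      rw [if_neg (by simp [h.terminal, ht, ht'])]
      exact (runs_compute hX _).bind hrun

theorem runs_classifyCase (h : T.IsLabelling μ) (hX : Fits X s) {q p p' : Q} {a b : A}
    (hp : IsPeel (μ q) 0 a (μ p)) (hp' : IsPeel (μ q) 1 b (μ p'))
    (ha : T.out q 0 = some a) (hb : T.out q 1 = some b) (hn : T.next q 0 = some p)
    (hn' : T.next q 1 = some p') {fuel : ℕ} (hf : contCard (μ q) < fuel) :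
    ∃ o k, Runs X (classifyCase T fuel q) s (16 * contCard (μ q) + 6) (o, k) s ∧
      Composed T μ q p p' a b k o := by
  have hc := runs_contentSize h hX 0 hf
  rw [zero_add] at hc
  have h0 := hp.contCard
  have h1 := hp'.contCard
  by_cases hab : a = b
  · subst hab
    refine ⟨.i, contCard (μ q), ?_, (h.least q).eq_of_eq hp hp'⟩
    refine (hc.bind <| (runs_out hX ha).bind <| (runs_out hX hb).bind <|
      (runs_compute hX _).bind (t' := 0) ?_).mono (by omega)
    rw [if_pos (by simp)]
    exact runs_pure _
  · have hp0 : μ p ≠ [] := by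
      intro h0
      have hb := (hp.mem_iff b).1 hp'.mem
      simp [h0, Ne.symm hab] at hb
    obtain ⟨o, k, hrun, ho⟩ := runs_classifyLoop h hX (c := contCard (μ q)) hp hp' hab ha hb
      (contCard (μ q)) 0 p p' rfl rfl hp0 (by omega) (by omega) (by omega) ⟨[], rfl⟩
      ⟨[], by simp⟩ fun x t y hx hy => ⟨⟨x, hx⟩, ⟨y, hy⟩⟩
    refine ⟨o, k, ?_, ho⟩
    refine (hc.bind <| (runs_out hX ha).bind <| (runs_out hX hb).bind <|
      (runs_compute hX _).bind (t' := 2 + 13 * contCard (μ q)) ?_).mono (by omega)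
    rw [if_neg (by simpa using hab)]
    exact ((runs_next hX hn).bind <| (runs_next hX hn').bind hrun).mono (by omega)

end Classify

end RAM

/-! ### Correctness and running time of `MinWord` -/

namespace RAM

section MinWord

variable {A Q : Type} {T : Transducer Q (Fin 2) A} {μ : Q → List A}

/-- The invariant of `MinWord`: wherever `B(q) = (i, j)` is defined, `w_{(i,j)} = μ q`, and the
domain of `B` contains the terminal states and is closed under transitions. -/
structure ValidTable (T : Transducer Q (Fin 2) A) (μ : Q → List A) (w : List A)
    (B : Q → Option (ℕ × ℕ)) : Prop where
  eq_of_nil : ∀ q, μ q = [] → B q = some (0, 0)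
  position : ∀ q i j, B q = some (i, j) → μ q ≠ [] →
    ∃ r s, w = r ++ μ q ++ s ∧ i = r.length + 1 ∧ j = r.length + (μ q).length
  closed : ∀ q β p, B q ≠ none → T.next q β = some p → B p ≠ none

theorem ValidTable.append {w : List A} {B : Q → Option (ℕ × ℕ)} (h : ValidTable T μ w B)
    (v : List A) : ValidTable T μ (w ++ v) B where
  eq_of_nil := h.eq_of_nil
  position q i j hB hq := by
    obtain ⟨r, s, hw, hi, hj⟩ := h.position q i j hB hq
    exact ⟨r, s ++ v, by simp [hw], hi, hj⟩
  closed := h.closed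

theorem ValidTable.closed_word {w : List A} {B : Q → Option (ℕ × ℕ)} (h : ValidTable T μ w B)
    {q p : Q} {α : List (Fin 2)} (hq : B q ≠ none) (hp : T.nextWord q α = some p) :
    B p ≠ none := by
  induction α generalizing q with
  | nil =>
    obtain rfl : q = p := by simpa [Transducer.nextWord] using hp
    exact hq
  | cons β α ih =>
    rw [Transducer.nextWord] at hp
    obtain ⟨q', hq', hp⟩ := Option.bind_eq_some_iff.1 hp
    exact ih (h.closed q β q' hq hq') hp

/-- The length that `subwordLength` computes from an entry `B(q)` is that of `μ q`, also for the
entries `(0, 0)` at terminal states. -/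
theorem ValidTable.subwordLength {w : List A} {B : Q → Option (ℕ × ℕ)} (h : ValidTable T μ w B)
    {q : Q} {i j : ℕ} (hq : B q = some (i, j)) :
    (if 0 < i ∧ i ≤ j then j - i + 1 else 0) = (μ q).length := by
  by_cases hn : μ q = []
  · rw [h.eq_of_nil q hn] at hq
    obtain ⟨rfl, rfl⟩ := Prod.mk.inj (Option.some_injective _ hq)
    simp [hn]
  · obtain ⟨r, s, -, rfl, rfl⟩ := h.position q i j hq hn
    have := List.length_pos_of_ne_nil hn
    rw [if_pos (by omega)]
    omega

theorem runs_appendSubword {X : ℕ} {r u v w : List A} {B : Q → Option (ℕ × ℕ)} {d i j : ℕ}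
    (hX : Fits X ⟨w ++ u, B, d⟩) (hw : w = r ++ u ++ v)
    (h : (u = [] ∧ ¬(0 < i ∧ i ≤ j)) ∨
      (u ≠ [] ∧ i = r.length + 1 ∧ j = r.length + u.length)) :
    Runs X (appendSubword i j) ⟨w, B, d⟩ (4 * u.length + 5) () ⟨w ++ u, B, d⟩ := by
  have hX' : Fits X ⟨w, B, d⟩ := hX.mono (by simp) le_rfl
  refine (Runs.bind (runs_subwordLength hX' i j) (t' := 4 * u.length + 1) ?_).mono (by omega)
  rcases h with ⟨rfl, h⟩ | ⟨hu, rfl, rfl⟩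
  · rw [if_neg h]
    simpa [copyLetters] using runs_compute hX' ()
  · have := List.length_pos_of_ne_nil hu
    rw [if_pos (by omega), show r.length + u.length - (r.length + 1) + 1 = u.length by omega]
    exact runs_copyLetters hX hw

/-- The number of states at which `B` is defined. -/
noncomputable def domCard (B : Q → Option (ℕ × ℕ)) : ℕ := {q | B q ≠ none}.ncard

theorem domCard_update [DecidableEq Q] [Finite Q] {B : Q → Option (ℕ × ℕ)} {q : Q}
    (h : B q = none) (ij : ℕ × ℕ) : domCard (Function.update B q (some ij)) = domCard B + 1 := by
  have : {p | Function.update B q (some ij) p ≠ none} = insert q {p | B p ≠ none} := by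
    ext p
    by_cases hp : p = q
    · subst hp
      simp
    · simp [hp]
  rw [domCard, this, Set.ncard_insert_of_notMem (by simp [h])]
  rfl

/-- The entry that `MinWord` makes at the end of a call keeps the table valid. -/
theorem ValidTable.update [DecidableEq Q] {w : List A} {B : Q → Option (ℕ × ℕ)}
    (h : ValidTable T μ w B) {q : Q} (hq : μ q ≠ [])
    (hnext : ∀ β p, T.next q β = some p → B p ≠ none) {r : List A} (hw : w = r ++ μ q) :
    ValidTable T μ w (Function.update B q (some (r.length + 1, w.length))) where
  eq_of_nil p hp := by
    have : p ≠ q := by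
      rintro rfl
      exact hq hp
    rw [Function.update_of_ne this, h.eq_of_nil p hp]
  position p i j hB hp := by
    by_cases hpq : p = q
    · subst hpq
      rw [Function.update_self] at hB
      obtain ⟨rfl, rfl⟩ := Prod.mk.inj (Option.some_injective _ hB)
      exact ⟨r, [], by simpa using hw, rfl, by simp [hw]⟩
    · rw [Function.update_of_ne hpq] at hB
      exact h.position p i j hB hp
  closed p β p' hB hp := by
    have : B p' ≠ none := by
      by_cases hpq : p = q
      · exact hnext β p' (hpq ▸ hp)
      · rw [Function.update_of_ne hpq] at hB
        exact h.closed p β p' hB hp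
    by_cases hpq : p' = q
    · subst hpq
      simp
    · rwa [Function.update_of_ne hpq]

variable [LinearOrder A]

/-- The letters appended by `extendWord`, followed by the part of `μ p'` that is not yet present,
complete the prefix `μ p` to `μ q`. The part of `μ p'` already present is `μ r` for some state `r`
that is reached from `p'` on a path labelled `00⋯0` and at which `B` is defined. -/
theorem runs_extendWord (h : T.IsLabelling μ) {X : ℕ} {q p p' : Q} {a b : A} {k d : ℕ}
    {o : OverlapCase} {w : List A} {B : Q → Option (ℕ × ℕ)}
    (ho : Composed T μ q p p' a b k o)
    (ha : T.out q 0 = some a) (hb : T.out q 1 = some b) (hn : T.next q 0 = some p)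
    (hB : ValidTable T μ w B) (hBp : B p ≠ none) (hw : μ p <:+ w) :
    ∃ x l' k' r, T.nextWord p' (List.replicate k' 0) = some r ∧ B r ≠ none ∧
      l' = (μ r).length ∧ μ r <:+ w ++ x ∧ μ q = μ p ++ x ++ (μ p').drop l' ∧
      (Fits X ⟨w ++ x, B, d⟩ → Runs X (extendWord T q k o) ⟨w, B, d⟩
        (2 * contCard (μ q) + 7) l' ⟨w ++ x, B, d⟩) := by
  obtain ⟨k₀, r₀, hr₀, hr₀'⟩ := h.exists_nil p'
  have hBr₀ : B r₀ ≠ none := by simp [hB.eq_of_nil r₀ hr₀']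
  match o, ho with
  | .i, ho =>
    refine ⟨[a], 0, k₀, r₀, hr₀, hBr₀, by simp [hr₀'], by simp [hr₀'], ?_, fun hX => ?_⟩
    · have ho : μ q = μ p ++ a :: μ p' := ho
      simp [ho]
    · have hX' : Fits X ⟨w, B, d⟩ := hX.mono (by simp) le_rfl
      refine Runs.mono (t := 1 + (1 + 1)) ?_ (by omega)
      exact (runs_out hX' ha).bind <| (runs_appendLetter hX).bind (runs_compute hX _)
  | .ii, ⟨hk, r, u, v, hr, hr', hu, hv, hq⟩ =>
    have hBr : B r ≠ none := hB.closed_word hBp hr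
    refine ⟨[], (μ r).length, k, r, hr', hBr, rfl, ?_, by simp [hq, hv], fun hX => ?_⟩
    · rw [List.append_nil]
      exact List.IsSuffix.trans ⟨u, hu.symm⟩ hw
    · rw [List.append_nil] at hX ⊢
      refine Runs.mono (t := 1 + (2 * k + 1 + (1 + 4))) ?_ (by omega)
      refine (runs_next hX hn).bind <| (runs_nextIterate hX hr).bind <| (runs_lookup hX r).bind ?_
      obtain ⟨⟨i, j⟩, hij⟩ := Option.ne_none_iff_exists'.1 hBr
      rw [← hB.subwordLength hij]
      simp only [hij]
      exact runs_subwordLength hX i j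
  | .iii, ho =>
    refine ⟨[a, b], 0, k₀, r₀, hr₀, hBr₀, by simp [hr₀'], by simp [hr₀'], ?_, fun hX => ?_⟩
    · have ho : μ q = μ p ++ a :: b :: μ p' := ho
      simp [ho]
    · have hX' : Fits X ⟨w ++ [a], B, d⟩ := hX.mono (by simp) le_rfl
      have hX'' : Fits X ⟨w, B, d⟩ := hX.mono (by simp) le_rfl
      have e : w ++ [a, b] = w ++ [a] ++ [b] := by simp
      rw [e] at hX ⊢
      refine Runs.mono (t := 1 + (1 + (1 + (1 + 1)))) ?_ (by omega)
      exact (runs_out hX'' ha).bind <| (runs_appendLetter hX').bind <| (runs_out hX' hb).bind <|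
        (runs_appendLetter (s := ⟨w ++ [a], B, d⟩) hX).bind (runs_compute hX _)

variable [DecidableEq Q] [DecidablePred (· ∈ T.terminal)]

/-- A call at a state where `B` is defined copies the missing letters from the known occurrence. -/
theorem runs_minWord_of_eq_some {X : ℕ} {q : Q} {fuel i j d : ℕ} {u v w : List A}
    {B : Q → Option (ℕ × ℕ)} (hB : ValidTable T μ w B) (hq : B q = some (i, j))
    (huv : μ q = u ++ v) (hX : Fits X ⟨w ++ v, B, d + 1⟩) :
    Runs X (minWord T (fuel + 1) q u.length) ⟨w, B, d⟩ (4 * v.length + 12) () ⟨w ++ v, B, d⟩ := by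
  have hX' : Fits X ⟨w, B, d + 1⟩ := hX.mono (by simp) le_rfl
  have happ : Runs X (appendSubword (i + u.length) j) ⟨w, B, d + 1⟩ (4 * v.length + 5) ()
      ⟨w ++ v, B, d + 1⟩ := by
    by_cases hn : μ q = []
    · rw [hB.eq_of_nil q hn] at hq
      obtain ⟨rfl, rfl⟩ := Prod.mk.inj (Option.some_injective _ hq)
      obtain ⟨rfl, rfl⟩ := List.append_eq_nil_iff.1 (huv.symm.trans hn)
      exact runs_appendSubword (r := w) (v := []) hX (by simp) (.inl (by simp))
    · obtain ⟨r, s, hw, rfl, rfl⟩ := hB.position q i j hq hn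
      refine runs_appendSubword (r := r ++ u) (v := s) hX (by simp [hw, huv]) ?_
      simp only [huv, List.length_append]
      by_cases hv : v = []
      · subst hv
        exact .inl ⟨rfl, by simp⟩
      · exact .inr ⟨hv, by omega, by omega⟩
  rw [minWord]
  refine (Runs.bind (runs_pushFrame hX') <| (runs_wordLength hX').bind <|
    (runs_compute hX' _).bind <| (runs_compute hX' _).bind <|
    (runs_lookup hX' q).bind (t' := 4 * v.length + 7) ?_).mono (by omega)
  simp only [hq]
  exact ((runs_compute hX' _).bind <| happ.bind (runs_popFrame hX)).mono (by omega)


/-- The call `MinWord(T, q, w, l, B)` appends to `w` the word `μ q` without its first `l` letters,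
which are the last `l` letters of `w`. At most `|cont (μ q)| + 1` activation records are added to the
stack. Up to a constant, a call is paid for by the states at which it defines `B`, at `O(N)` per
state, and by the letters that it appends, at `O(1)` per letter. -/
theorem runs_minWord [Finite Q] (h : T.IsLabelling μ) (N X : ℕ) (n : ℕ) :
    ∀ (q : Q) (fuel : ℕ) (w : List A) (B : Q → Option (ℕ × ℕ)) (d k : ℕ) (r : Q),
      contCard (μ q) = n → n ≤ N → n + 1 < fuel → ValidTable T μ w B →
      T.nextWord q (List.replicate k 0) = some r → B r ≠ none → μ r <:+ w →
      Fits X ⟨w ++ (μ q).drop (μ r).length, B, d + n + 1⟩ →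
      ∃ B' t, Runs X (minWord T fuel q (μ r).length) ⟨w, B, d⟩ t ()
          ⟨w ++ (μ q).drop (μ r).length, B', d⟩ ∧
        ValidTable T μ (w ++ (μ q).drop (μ r).length) B' ∧ B' q ≠ none ∧
        (∀ p, B p ≠ none → B' p ≠ none) ∧ (∀ p, n < contCard (μ p) → B' p = B p) ∧
        t + 40 * (N + 1) * domCard B ≤
          40 * (N + 1) * domCard B' + 4 * ((μ q).drop (μ r).length).length + 12 := by
  have hdef : ∀ (n : ℕ) (q : Q) (fuel : ℕ) (w : List A) (B : Q → Option (ℕ × ℕ)) (d k : ℕ) (r : Q),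
      n + 1 < fuel → ValidTable T μ w B → T.nextWord q (List.replicate k 0) = some r →
      Fits X ⟨w ++ (μ q).drop (μ r).length, B, d + n + 1⟩ → B q ≠ none →
      Runs X (minWord T fuel q (μ r).length) ⟨w, B, d⟩
        (4 * ((μ q).drop (μ r).length).length + 12) () ⟨w ++ (μ q).drop (μ r).length, B, d⟩ := by
    intro n q fuel w B d k r hf hB hr hX hq
    obtain ⟨⟨i, j⟩, hij⟩ := Option.ne_none_iff_exists'.1 hq
    obtain ⟨g, hg⟩ := h.exists_eq_append hr
    obtain ⟨fuel, rfl⟩ : ∃ f, fuel = f + 1 := ⟨fuel - 1, by omega⟩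
    exact runs_minWord_of_eq_some hB hij (by simp [hg]) (hX.mono le_rfl (by simp +arith))
  induction n with
  | zero =>
    intro q fuel w B d k r hn _ hf hB hr _ _ hX
    have hBq : B q ≠ none := by simp [hB.eq_of_nil q (contCard_eq_zero.1 hn)]
    exact ⟨B, _, hdef 0 q fuel w B d k r hf hB hr hX hBq, hB.append _, hBq, fun _ h => h,
      fun _ _ => rfl, by omega⟩
  | succ n ih =>
    intro q fuel w B d k r hn hN hf hB hr hBr hw hX
    by_cases hBq : B q = none
    swap
    · exact ⟨B, _, hdef _ q fuel w B d k r hf hB hr hX hBq, hB.append _, hBq, fun _ h => h,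
        fun _ _ => rfl, by omega⟩
    have hq : μ q ≠ [] := fun h0 => by
      rw [contCard_eq_zero.2 h0] at hn
      omega
    obtain ⟨a, p, hp, ha, hup⟩ := h.step q 0 hq
    obtain ⟨b, p', hp', hb, hup'⟩ := h.step q 1 hq
    have hcp := hup.contCard
    have hcp' := hup'.contCard
    obtain ⟨fuel, rfl⟩ : ∃ f, fuel = f + 1 := ⟨fuel - 1, by omega⟩
    -- as `B(q)` is undefined, `r ≠ q`
    obtain ⟨k, rfl⟩ : ∃ k', k = k' + 1 := by
      cases k with
      | zero =>
        obtain rfl : q = r := by simpa [Transducer.nextWord] using hr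
        exact absurd hBq hBr
      | succ k => exact ⟨k, rfl⟩
    have hr' : T.nextWord p (List.replicate k 0) = some r := by
      rwa [List.replicate_succ, Transducer.nextWord, hp, Option.bind_some] at hr
    obtain ⟨g, hg⟩ := h.exists_eq_append hr'
    obtain ⟨w₀, hw₀⟩ := hw
    obtain ⟨gp, hgp, -, -⟩ := id hup
    -- the first recursive call completes the prefix `μ p` of `μ q`
    have hg' : (μ p).drop (μ r).length = g := by simp [hg]
    have hgq : (μ q).drop (μ r).length = g ++ a :: gp := by simp [hgp, hg]
    have hw₁ : w ++ g = w₀ ++ μ p := by rw [← hw₀, hg, List.append_assoc]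
    obtain ⟨B₁, t₁, hrun₁, hB₁, hB₁p, hmono₁, hsame₁, ht₁⟩ := ih p fuel w B (d + 1) k r (by omega)
      (by omega) (by omega) hB hr' hBr ⟨w₀, hw₀⟩
      (hX.mono (by rw [hg', hgq]; simp) (by simp +arith))
    rw [hg'] at hrun₁ hB₁ ht₁
    have hB₁q : B₁ q = none := by rw [hsame₁ q (by omega), hBq]
    have hX₁ : Fits X ⟨w ++ g, B₁, d + 1⟩ := hX.mono (by rw [hgq]; simp) (by simp +arith)
    obtain ⟨o, k', hcl, hco⟩ := runs_classifyCase h hX₁ (fuel := fuel) hup hup' ha hb hp hp'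
      (by omega)
    obtain ⟨x, l', k₂, r₂, hr₂, hBr₂, rfl, hw₂, hq₂, hext⟩ := runs_extendWord (d := d + 1) h hco
      ha hb hp hB₁ hB₁p ⟨w₀, hw₁.symm⟩
    -- the second recursive call completes `μ q`
    set y := (μ p').drop (μ r₂).length with hy
    have hxy : a :: gp = x ++ y := by
      rw [hgp, List.append_assoc] at hq₂
      exact List.append_cancel_left hq₂
    rw [hgq, hxy] at hX ⊢
    have hX₂ : Fits X ⟨w ++ g ++ x, B₁, d + 1⟩ := hX.mono (by simp) (by simp +arith)
    obtain ⟨B₂, t₂, hrun₂, hB₂, hB₂p', hmono₂, hsame₂, ht₂⟩ := ih p' fuel (w ++ g ++ x) B₁ (d + 1)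
      k₂ r₂ (by omega) (by omega) (by omega) (hB₁.append x) hr₂ hBr₂ hw₂
      (hX.mono (by simp [hy]) (by simp +arith))
    rw [← hy] at hrun₂ hB₂ ht₂
    have hB₂q : B₂ q = none := by rw [hsame₂ q (by omega), hB₁q]
    have hfin : w ++ (g ++ (x ++ y)) = w ++ g ++ x ++ y := by simp
    have hwq : w ++ g ++ x ++ y = w₀ ++ μ q := by rw [hq₂, hw₁]; simp
    rw [hfin] at hX ⊢
    have hX₃ : Fits X ⟨w ++ g ++ x ++ y, B₂, d + 1⟩ := hX.mono le_rfl (by simp +arith)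
    have hs : w.length - (μ r).length + 1 = w₀.length + 1 := by
      rw [← hw₀, List.length_append]
      omega
    refine ⟨Function.update B₂ q (some (w₀.length + 1, (w ++ g ++ x ++ y).length)),
      5 + (1 + (t₁ + (16 * contCard (μ q) + 6 +
        (2 * contCard (μ q) + 7 + (1 + (t₂ + (1 + (1 + 1)))))))), ?_,
      hB₂.update hq (fun β p₁ hp₁ => ?_) hwq, by simp, fun p₁ hp₁ => ?_, fun p₁ hp₁ => ?_, ?_⟩
    · have hX₀ : Fits X ⟨w, B, d + 1⟩ := hX₁.mono (by simp) le_rfl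
      rw [minWord]
      refine (Runs.bind (runs_pushFrame hX₀) <| (runs_wordLength hX₀).bind <|
        (runs_compute hX₀ _).bind <| (runs_compute hX₀ _).bind <|
        (runs_lookup hX₀ q).bind
          (t' := 1 + (t₁ + (16 * contCard (μ q) + 6 +
            (2 * contCard (μ q) + 7 + (1 + (t₂ + (1 + (1 + 1))))))))
          ?_).mono (by omega)
      simp only [hBq, hs]
      exact (runs_next hX₀ hp).bind <| hrun₁.bind <| hcl.bind <| (hext hX₂).bind <|
        (runs_next hX₂ hp').bind <| hrun₂.bind <| (runs_wordLength hX₃).bind <|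
        (runs_assign hX₃ q _).bind (runs_popFrame hX₃)
    · match β with
      | 0 =>
        obtain rfl := Option.some_injective _ (hp.symm.trans hp₁)
        exact hmono₂ _ hB₁p
      | 1 =>
        obtain rfl := Option.some_injective _ (hp'.symm.trans hp₁)
        exact hB₂p'
    · by_cases hpq : p₁ = q
      · subst hpq
        simp
      · rw [Function.update_of_ne hpq]
        exact hmono₂ _ (hmono₁ _ hp₁)
    · have hpq : p₁ ≠ q := by
        rintro rfl
        omega
      rw [Function.update_of_ne hpq, hsame₂ _ (by omega), hsame₁ _ (by omega)]
    · rw [domCard_update hB₂q]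
      simp only [List.length_append]
      have h1 : 40 * (N + 1) * (domCard B₂ + 1) = 40 * (N + 1) * domCard B₂ + 40 * (N + 1) := by
        ring
      rw [h1]
      generalize 40 * (N + 1) * domCard B₂ = D₂ at *
      generalize 40 * (N + 1) * domCard B₁ = D₁ at *
      generalize 40 * (N + 1) * domCard B = D at *
      omega

end MinWord

end RAM

/-! ### Outcome and cost of the whole computation -/

/-- Once a run halts, more fuel does not change its outcome. -/
theorem minWordHaltsWith_of_eq_some {A Q : Type} [DecidableEq A] [DecidableEq Q]
    {T : Transducer Q (Fin 2) A} [DecidablePred (· ∈ T.terminal)] {q : Q} {w : List A} {l : ℕ}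
    {B : Q → Option (ℕ × ℕ)} {m : Mem A Q} {N : ℕ}
    (h : RAM.minWord T N q l
      { word := w, table := B, frames := 0, time := 0, peak := cells Q w 0 } = some ((), m)) :
    MinWordHaltsWith T q w l B m := by
  refine ⟨N, fun fuel hf => ?_⟩
  induction fuel, hf using Nat.le_induction with
  | base => exact h
  | succ fuel _ ih => exact RAM.minWord_extends _ _ _ _ _ ih

theorem Transducer.IsLabelling.exists_minWordHaltsWith {A : Type} [LinearOrder A] {Q : Type}
    [DecidableEq Q] [Finite Q] {T : Transducer Q (Fin 2) A} [DecidablePred (· ∈ T.terminal)]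
    {μ : Q → List A} (h : T.IsLabelling μ) :
    ∃ m : Mem A Q, MinWordHaltsWith T T.init [] 0 (initialTable T) m ∧ m.word = μ T.init ∧
      m.time ≤ 40 * (contCard (μ T.init) + 1) * Nat.card Q + 4 * (μ T.init).length + 12 ∧
      m.peak ≤ 40 * Nat.card Q + (μ T.init).length + 8 := by
  obtain ⟨k, r, hr, hr0⟩ := h.exists_nil T.init
  have hB : RAM.ValidTable T μ [] (initialTable T) :=
    { eq_of_nil := fun q hq => if_pos ((h.terminal q).2 hq)
      position := fun q i j hij hq => by
        rw [initialTable, if_neg fun h' => hq ((h.terminal q).1 h')] at hij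
        exact absurd hij (by simp)
      closed := fun q β p hq hp => by
        have : q ∈ T.terminal := by
          by_contra h'
          exact hq (if_neg h')
        rw [h.next_eq_none q β ((h.terminal q).1 this)] at hp
        exact absurd hp (by simp) }
  set n := contCard (μ T.init) with hn
  obtain ⟨B', t, hrun, -, -, -, -, ht⟩ := RAM.runs_minWord h n
    (cells Q (μ T.init) (n + 1)) n T.init (n + 2) [] (initialTable T) 0 k r rfl le_rfl (by omega)
    hB hr (by simp [hB.eq_of_nil r hr0]) (by simp [hr0])
    (by rw [RAM.Fits]; simp [hr0])
  rw [hr0] at hrun ht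
  obtain ⟨m, hm, hw, -, -, htime, hpeak⟩ := hrun
    { word := [], table := initialTable T, frames := 0, time := 0, peak := cells Q ([] : List A) 0 }
    rfl rfl rfl
  simp only [List.length_nil, List.drop_zero, List.nil_append] at hm hw ht
  refine ⟨m, minWordHaltsWith_of_eq_some hm, hw, ?_, ?_⟩
  · have hdom : RAM.domCard B' ≤ Nat.card Q := by
      rw [RAM.domCard, ← Set.ncard_univ]
      exact Set.ncard_le_ncard (Set.subset_univ _)
    have := Nat.mul_le_mul_left (40 * (n + 1)) hdom
    simp only at htime
    omega
  · have := h.contCard_lt_card T.init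
    simp only [cells, List.length_nil] at hpeak
    omega

end FreeBands

theorem mainTheorem2 :
    ∃ C : ℕ, ∀ (A : Type) [LinearOrder A] [Nonempty A] (x : FreeBands.FreeBand A)
      (Q : Type) [DecidableEq Q] (T : FreeBands.Transducer Q (Fin 2) A)
      [DecidablePred (· ∈ T.terminal)],
      T.IsMinimalRepresenting x →
        Finite Q ∧
        ∃ m : FreeBands.Mem A Q,
          FreeBands.MinWordHaltsWith T T.init [] 0 (FreeBands.initialTable T) m ∧
          FreeBands.IsMinWord x m.word ∧
          (Finite A →
            m.time ≤ C * (Nat.card A * Nat.card Q + m.word.length) ∧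
            m.peak ≤ C * (Nat.card Q + m.word.length) ∧
            (x ≠ 1 →
              Nat.card A * Nat.card Q + m.word.length
                ≤ C * (Nat.card A ^ 2 * m.word.length) ∧
              m.time ≤ C * (Nat.card A ^ 2 * m.word.length) ∧
              Nat.card Q + m.word.length ≤ C * (Nat.card A * m.word.length) ∧
              m.peak ≤ C * (Nat.card A * m.word.length))) := by
  -- `92` from the time bound `ht` times `6` from `|A| |Q| + |z| ≤ 6 |A|² |z|` is the largest factor
  refine ⟨600, fun A _ _ x Q _ T _ hT => ?_⟩
  obtain ⟨hQ, μ, hμ, hx⟩ := hT.exists_isLabelling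
  obtain ⟨m, hm, hw, htime, hpeak⟩ := hμ.exists_minWordHaltsWith
  refine ⟨hQ, m, hm, by rwa [hw], fun hA => ?_⟩
  rw [hw]
  have hcA : FreeBands.contCard (μ T.init) ≤ Nat.card A := by
    rw [FreeBands.contCard, ← Set.ncard_coe_finset, ← Set.ncard_univ]
    exact Set.ncard_le_ncard (Set.subset_univ _)
  have hQ0 : 0 < Nat.card Q := (Nat.zero_le _).trans_lt (hμ.contCard_lt_card T.init)
  have hA0 : 0 < Nat.card A := Nat.card_pos
  have hQle := hμ.card_le
  have hlen : x ≠ 1 → 0 < (μ T.init).length := fun hx1 => by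
    refine List.length_pos_of_ne_nil fun h0 => hx1 ?_
    rw [← hx.1, h0]
    rfl
  generalize Nat.card Q = c at *
  generalize Nat.card A = a at *
  generalize (μ T.init).length = L at *
  generalize FreeBands.contCard (μ T.init) = n at *
  have h1 : n * c ≤ a * c := Nat.mul_le_mul_right c hcA
  have h2 : c ≤ a * c := Nat.le_mul_of_pos_left c hA0
  have ht : m.time ≤ 92 * (a * c + L) := by linarith
  have hp : m.peak ≤ 48 * (c + L) := by linarith
  refine ⟨by linarith, by linarith, fun hx1 => ?_⟩
  have hL := hlen hx1
  have h3 : c ≤ 5 * (a * L) := by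
    have h4 : L * n ≤ a * L := by rw [mul_comm]; exact Nat.mul_le_mul_right L hcA
    have h5 : a ≤ a * L := Nat.le_mul_of_pos_right a hL
    linarith
  have h4 : L ≤ a * L := Nat.le_mul_of_pos_left L hA0
  have h5 : a * L ≤ a ^ 2 * L := by rw [sq, mul_assoc]; exact Nat.le_mul_of_pos_left _ hA0
  have h6 : a * c ≤ 5 * (a ^ 2 * L) := by
    calc a * c ≤ a * (5 * (a * L)) := Nat.mul_le_mul_left a h3
      _ = 5 * (a ^ 2 * L) := by ring
  exact ⟨by linarith, by linarith, by linarith, by linarith⟩
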